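/- **Setting.** Fix an integer $c\ge 0$. A *DRMDP with overlap $c$* (DRMDP-$c$) consists of a measurable state space $S$, a measurable action space $A$, an initial law $p(s_0)$, a Markov transition kernel $p(s'\mid s,a)$, a probability law $q_n$ on the positive integers, a discount factor $\gamma\in[0,1)$, and measurable reward functions $r$. Time is divided into consecutive signal intervals whose lengths $n_1,n_2,\dots$ are drawn independently from $q_n$; the $i$-th interval starts at $t_i=\sum_{j<i}n_j$ and its (expected) reward is $r(\tau_{t_i-c:t_{i+1}})$, where $\tau_{a:b}=((s_a,a_a),\dots,(s_{b-1},a_{b-1}))$ and negative times are filled with a zero token. There are $B_n\ge 0$ such that $|r|\le B_n$ on segments belonging to an interval of length $n$, for every $n$ with $q_n(n)>0$, and $\sum_n q_n(n)\gamma^{n-1}B_n<\infty$. (This holds for bounded rewards, and whenever $S$, $A$ and the support of $q_n$ are finite; it makes the return below absolutely convergent.) A policy in $\Pi_{\mathrm{all}}$ chooses $a_t$ from a law $\pi(\cdot\mid\tau_{0:t},s_t,n_1,\dots,n_{i-1})$, where $i=i(t)$ is the interval containing $t$ and $n_1,\dots,n_{i-1}$ are the lengths of the completed intervals, measurably in $(\tau_{0:t},s_t)$;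 the length of the current interval is not observed before it ends. A policy is *optimal* if it maximizes $$\mathcal J(\pi)=\mathbb E_{\pi}\Big[\sum_{i\ge1}\gamma^{t_{i+1}-1}\,r(\tau_{t_i-c:t_{i+1}})\Big]$$ over $\Pi_{\mathrm{all}}$. Let $\Pi_{\tau,c}\subseteq\Pi_{\mathrm{all}}$ be the policies of the form $\pi(a_t\mid\tau_{t_i-c:t},s_t)$ (so $\Pi_\tau=\Pi_{\tau,0}$), and $\Pi_s$ those of the form $\pi(a_t\mid s_t,t-t_i)$. **Statement.** Let $c\ge 0$. 1. Every DRMDP-$c$ with a finite non-empty action space (every subset of $A$ measurable) has an optimal policy that lies in $\Pi_{\tau,c}$. 2. More generally, for every DRMDP-$c$ whose action space is a standard Borel space: if it has an optimal policy in $\Pi_{\mathrm{all}}$ at all, then it has an optimal policy that lies in $\Pi_{\tau,c}$. 3. There is a DRMDP-$c$ that has optimal policies, none of which lies in $\Pi_s$. Explicitly, for every $\gamma\in(0,1)$: the states are $A_0,A_1,B,C$; the initial state is $A_0$ or $A_1$ with probability $\tfrac12$ each; every interval has length $2$; whatever the actions, $A_0,A_1$ lead to $B$, $B$ leads to $C$,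 and $C$ is absorbing; there are two actions $0,1$; an interval $((A_i,\cdot),(B,j))$ has reward $i\oplus j$ and every other interval has reward $0$, irrespective of the overlapping steps. -/

import Mathlib

open MeasureTheory ProbabilityTheory

universe u v

noncomputable section

namespace DelayedReward

/-- Interval lengths carry the discrete sigma-algebra. -/
instance instMeasurableSpacePNat : MeasurableSpace ℕ+ := ⊤

/-- An entry of a padded trajectory segment: a state-action pair, or the zero token `Sum.inl ()`
which marks positions before the beginning of the trajectory. -/
abbrev Token (S : Type u) (A : Type v) : Type (max u v) := Unit ⊕ (S × A)

/-- A delayed reward Markov decision process whose rewards overlap with at most `c` steps before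
the signal interval.  The expected reward of an interval of length `n` that starts at time `t` is
`reward n` of the segment `τ_{t-c:t+n}`, which has `c + n` entries (zero tokens at negative
times).  The last field makes the expected discounted return converge absolutely: it holds
for bounded rewards, and always when `S`, `A` and the support of `lengthLaw` are finite. -/
structure DRMDP (c : ℕ) (S : Type u) (A : Type v) [MeasurableSpace S] [MeasurableSpace A] where
  /-- the law of the initial state -/
  init : Measure S
  isProbabilityMeasure_init : IsProbabilityMeasure init
  /-- the Markov transition function `p(s' | s, a)` -/
  trans : Kernel (S × A) S
  isMarkovKernel_trans : IsMarkovKernel trans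
  /-- the law `q_n` of the length of a signal interval -/
  lengthLaw : PMF ℕ+
  /-- the expected reward of a signal interval -/
  reward : (n : ℕ+) → (Fin (c + n) → Token S A) → ℝ
  measurable_reward : ∀ n, Measurable (reward n)
  /-- the discount factor `γ` -/
  discount : ℝ
  discount_nonneg : 0 ≤ discount
  discount_lt_one : discount < 1
  summable_reward : ∃ B : ℕ+ → ℝ,
    (∀ n ∈ lengthLaw.support, ∀ τ, |reward n τ| ≤ B n) ∧
      Summable fun n : ℕ+ => (lengthLaw n).toReal * discount ^ ((n : ℕ) - 1) * B n

/-- The first time step `t_i` of the `i`-th signal interval (`i = 0, 1, 2, …`), when the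
interval lengths are `n 0, n 1, n 2, …`. -/
def startTime (n : ℕ → ℕ+) (i : ℕ) : ℕ := ∑ j ∈ Finset.range i, (n j : ℕ)

/-- The index `i(t)` of the signal interval that time `t` belongs to: the largest `i` with
`t_i ≤ t` (as `i ≤ t_i`, it is at most `t`). -/
def intervalIndex (n : ℕ → ℕ+) (t : ℕ) : ℕ := Nat.findGreatest (fun i => startTime n i ≤ t) t

/-- The lengths of the signal intervals that are completed before time `t`, in order. -/
def completedLengths (n : ℕ → ℕ+) (t : ℕ) : List ℕ+ := (List.range (intervalIndex n t)).map n

/-- The total duration of a list of intervals: if the list holds the lengths of the completed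
intervals, this is the first time step `t_i` of the current one. -/
def duration (L : List ℕ+) : ℕ := (L.map fun m => (m : ℕ)).sum

variable {S : Type u} {A : Type v}

/-- The segment `τ_{a-c:a+k}` of an infinite trajectory, with zero tokens at negative times. -/
def trajSegment (c : ℕ) (ω : ℕ → S × A) (a k : ℕ) : Fin (c + k) → Token S A :=
  fun j => if c ≤ a + j then Sum.inr (ω (a + j - c)) else Sum.inl ()

/-- The segment `τ_{a-c:t}` of a history `τ_{0:t}`, where `a ≤ t`, with zero tokens at
negative times. -/
def historySegment (c : ℕ) {t : ℕ} (τ : Fin t → S × A) (a : ℕ) :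
    Fin (c + (t - a)) → Token S A :=
  fun j => if h : c ≤ a + j ∧ a + j - c < t then Sum.inr (τ ⟨a + j - c, h.2⟩) else Sum.inl ()

variable [MeasurableSpace S] [MeasurableSpace A]

variable (S A) in
/-- A general randomized policy (the class `Π_all`): `act t L (τ, s)` is the law of the action
at time `t`, given the lengths `L` of the signal intervals completed before time `t`, the history
`τ = τ_{0:t}` and the current state `s = s_t`.  (Only lists `L` of duration at most `t` occur.) -/
structure Policy where
  act : (t : ℕ) → List ℕ+ → Kernel ((Fin t → S × A) × S) A
  isMarkovKernel_act : ∀ t L, IsMarkovKernel (act t L)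

/-- The class `Π_{τ,c}` of policies `π(a_t | τ_{t_i-c:t} ∘ s_t)`; for `c = 0` this is `Π_τ`.
The segment `τ_{t_i-c:t}` has `c + (t - t_i)` entries. -/
def Policy.IsTau (c : ℕ) (π : Policy S A) : Prop :=
  ∃ σ : (k : ℕ) → Kernel ((Fin (c + k) → Token S A) × S) A,
    ∀ (t : ℕ) (L : List ℕ+), duration L ≤ t → ∀ (τ : Fin t → S × A) (s : S),
      π.act t L (τ, s) = σ (t - duration L) (historySegment c τ (duration L), s)

/-- The class `Π_s` of policies `π(a_t | s_t, t - t_i)`. -/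
def Policy.IsState (π : Policy S A) : Prop :=
  ∃ σ : ℕ → Kernel S A,
    ∀ (t : ℕ) (L : List ℕ+), duration L ≤ t → ∀ (τ : Fin t → S × A) (s : S),
      π.act t L (τ, s) = σ (t - duration L) s

namespace DRMDP

variable {c : ℕ} (M : DRMDP c S A) (π : Policy S A)

/-- The law of the first state-action pair `(s_0, a_0)`. -/
def initLaw : Measure (S × A) :=
  M.init ⊗ₘ (π.act 0 []).comap (fun s => (fun j : Fin 0 => j.elim0, s)) (by fun_prop)

/-- The conditional law of `(s_{t+1}, a_{t+1})` given `(s_0, a_0), …, (s_t, a_t)`, when the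
interval lengths are `n`. -/
def stepKernel (n : ℕ → ℕ+) (t : ℕ) : Kernel (Π _ : Finset.Iic t, S × A) (S × A) :=
  (M.trans.comap (fun h => h ⟨t, Finset.mem_Iic.2 le_rfl⟩) (by fun_prop)) ⊗ₖ
    (π.act (t + 1) (completedLengths n (t + 1))).comap
      (fun x => (fun j : Fin (t + 1) => x.1 ⟨j, Finset.mem_Iic.2 (Nat.le_of_lt_succ j.2)⟩, x.2))
      (by fun_prop)

instance : IsProbabilityMeasure (M.initLaw π) := by
  have := M.isProbabilityMeasure_init
  have := π.isMarkovKernel_act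
  unfold initLaw
  infer_instance

instance (n : ℕ → ℕ+) (t : ℕ) : IsMarkovKernel (M.stepKernel π n t) := by
  have := M.isMarkovKernel_trans
  have := π.isMarkovKernel_act
  unfold stepKernel
  infer_instance

/-- The law of the state-action trajectory under `π`, given the interval lengths `n`. -/
def trajLaw (n : ℕ → ℕ+) : Measure (ℕ → S × A) :=
  Kernel.trajMeasure (X := fun _ => S × A) (M.initLaw π) (M.stepKernel π n)

/-- The law of the sequence of interval lengths: independent draws from `lengthLaw`. -/
def lengthsLaw : Measure (ℕ → ℕ+) := Measure.infinitePi fun _ => M.lengthLaw.toMeasure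

/-- The discounted cumulative reward `∑ i, γ ^ (t_{i+1} - 1) r(τ_{t_i-c:t_{i+1}})`. -/
def discountedReturn (n : ℕ → ℕ+) (ω : ℕ → S × A) : ℝ :=
  ∑' i : ℕ, M.discount ^ (startTime n (i + 1) - 1) *
    M.reward (n i) (trajSegment c ω (startTime n i) (n i))

/-- The expected discounted cumulative reward `𝒥(π)`. -/
def value : ℝ := ∫ n, ∫ ω, M.discountedReturn n ω ∂(M.trajLaw π n) ∂M.lengthsLaw

/-- `π` is optimal: it maximizes the expected discounted cumulative reward over all policies. -/
def IsOptimal : Prop := ∀ π' : Policy S A, M.value π' ≤ M.value π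

end DRMDP

/-- The states of the exclusive-or example: the initial states `A_0 = start false` and
`A_1 = start true`, then `B = mid`, then the absorbing state `C = terminal`. -/
inductive XorState : Type
  | start (i : Bool)
  | mid
  | terminal

namespace XorState

instance : MeasurableSpace XorState := ⊤

instance : DiscreteMeasurableSpace XorState := ⟨fun _ => trivial⟩

instance : Finite XorState :=
  Finite.of_surjective
    (fun x : Option (Option Bool) => match x with
      | none => terminal
      | some none => mid
      | some (some i) => start i)
    (fun s => match s with
      | start i => ⟨some (some i), rfl⟩
      | mid => ⟨some none, rfl⟩
      | terminal => ⟨none, rfl⟩)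

/-- The deterministic dynamics `A_i → B → C → C → …`. -/
def next : XorState → XorState
  | start _ => mid
  | mid => terminal
  | terminal => terminal

end XorState

/-- The reward `i ⊕ j` of an interval `(A_i, _), (B, b_j)`; all other segments have reward 0. -/
def xorPairReward : Token XorState Bool → Token XorState Bool → ℝ
  | .inr (.start i, _), .inr (.mid, j) => if xor i j then 1 else 0
  | _, _ => 0

/-- The reward function of the exclusive-or example: it reads the two steps of the interval and
ignores the `c` overlapping steps before it. -/
def xorReward (c : ℕ) (n : ℕ+) (τ : Fin (c + n) → Token XorState Bool) : ℝ :=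
  if h : (n : ℕ) = 2 then xorPairReward (τ ⟨c, by omega⟩) (τ ⟨c + 1, by omega⟩) else 0

theorem abs_xorReward_le (c : ℕ) (n : ℕ+) (τ : Fin (c + n) → Token XorState Bool) :
    |xorReward c n τ| ≤ 1 := by
  unfold xorReward
  split
  · unfold xorPairReward
    split
    · split <;> simp
    · simp
  · simp

theorem measurable_xorReward (c : ℕ) (n : ℕ+) : Measurable (xorReward c n) := by
  have key : Measurable fun p : Token XorState Bool × Token XorState Bool =>
      xorPairReward p.1 p.2 := by
    have : DiscreteMeasurableSpace (Token XorState Bool) :=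
      ⟨fun s => measurableSet_sum_iff.2 ⟨.of_discrete, .of_discrete⟩⟩
    exact Measurable.of_discrete
  unfold xorReward
  split
  · next h =>
    have hτ : Measurable fun τ : Fin (c + n) → Token XorState Bool =>
        (τ ⟨c, by omega⟩, τ ⟨c + 1, by omega⟩) := by fun_prop
    exact key.comp hτ
  · exact measurable_const

/-- The exclusive-or example: every signal interval has length 2, the initial state is `A_0` or
`A_1` with probability 1/2 each, the dynamics do not depend on the action (at `A_0`, `A_1` and `C`
the two actions are interchangeable copies of the only one), and the first interval, which is
`(A_i, _), (B, b_j)`, has reward `i ⊕ j`; all later rewards vanish. -/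
def xorDRMDP (c : ℕ) (γ : ℝ) (h0 : 0 ≤ γ) (h1 : γ < 1) : DRMDP c XorState Bool where
  init := ((PMF.uniformOfFintype Bool).map XorState.start).toMeasure
  isProbabilityMeasure_init := inferInstance
  trans := Kernel.deterministic (fun x : XorState × Bool => x.1.next) (Measurable.of_discrete)
  isMarkovKernel_trans := inferInstance
  lengthLaw := PMF.pure 2
  reward := xorReward c
  measurable_reward := measurable_xorReward c
  discount := γ
  discount_nonneg := h0
  discount_lt_one := h1
  summable_reward := ⟨fun _ => 1, fun n _ τ => abs_xorReward_le c n τ,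
    summable_of_ne_finset_zero (s := {2}) fun n hn => by
      have hn' : n ≠ 2 := by simpa using hn
      simp [PMF.pure_apply, hn']⟩

end DelayedReward

end

open DelayedReward

open scoped ENNReal

/-! The length of the current interval is hidden from the policy. Given the completed lengths, the
law of the first steps of an interval therefore does not depend on when it ends
(`DRMDP.lintegral_trajLaw_trajSegment`), and every interval may be continued as if it lasted
forever. Summing these laws over all lists of completed lengths, weighted by their probability and
by `γ ^ t_i`, gives finite measures `occupation π k` of the segment, state and action at offset `k`
in an interval. By independence of the lengths, the return is a linear functional of these measures
(`DRMDP.value_eq_tsum_occupation`).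

Occupation measures satisfy flow equations that involve only the model (`DRMDP.isFlow_occupation`):
a step continues the segment, or ends the interval and keeps its last `c` entries. Because ending an
interval costs at least one factor `γ`, a flow is determined by its conditional action laws given
segment and state (`DRMDP.IsFlow.eq_of_disintegrates`). Disintegrating the occupation measures of an
arbitrary policy thus gives a policy in `Π_{τ,c}` with the same measures, hence the same value
(`DRMDP.exists_isTau_value_eq`). This settles the second claim.

For finitely many actions, value iteration downwards from a supersolution solves the optimality
equations on segments (`DRMDP.exists_optimality_equation`). Integrating a solution against a flow
telescopes: it bounds the value of every policy, with equality for a measurable selection of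
maximizing actions (`DRMDP.IsFlow.tsum_weightedReward`).

In the exclusive-or example a policy with memory answers `!i` and earns `γ`. A policy in `Π_s` acts
at `B` independently of `i`, so its two success probabilities sum to 1 and it earns only `γ / 2`. -/

namespace DelayedReward

/-! ### Trajectory laws for given interval lengths. -/

section Trajectory

variable {S : Type u} {A : Type v} [MeasurableSpace S] [MeasurableSpace A]

/-- The history `τ_{0:t}` of an infinite trajectory. -/
def history (t : ℕ) (ω : ℕ → S × A) : Fin t → S × A := fun j => ω j

@[fun_prop]
theorem measurable_history (t : ℕ) : Measurable (history t : (ℕ → S × A) → Fin t → S × A) := by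
  unfold history; fun_prop

instance (π : Policy S A) (t : ℕ) (L : List ℕ+) : IsMarkovKernel (π.act t L) :=
  π.isMarkovKernel_act t L

namespace DRMDP

variable {c : ℕ} (M : DRMDP c S A) (π : Policy S A)

instance : IsProbabilityMeasure M.init := M.isProbabilityMeasure_init

instance : IsMarkovKernel M.trans := M.isMarkovKernel_trans

instance (n : ℕ → ℕ+) : IsProbabilityMeasure (M.trajLaw π n) := by
  unfold trajLaw; infer_instance

theorem map_zero_trajLaw (n : ℕ → ℕ+) :
    (M.trajLaw π n).map (fun ω => ω 0) = M.initLaw π := by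
  have h : (M.trajLaw π n).map (Preorder.frestrictLe 0) =
      (M.initLaw π).map (MeasurableEquiv.piUnique (fun _ : Finset.Iic 0 => S × A)).symm := by
    rw [trajLaw, Kernel.trajMeasure, Measure.map_comp _ _ (by fun_prop),
      Kernel.traj_map_frestrictLe, Kernel.partialTraj_self, Measure.id_comp]
  have h2 : (fun ω : ℕ → S × A => ω 0) =
      (fun x : (Π _ : Finset.Iic 0, S × A) => x ⟨0, by simp⟩) ∘ Preorder.frestrictLe 0 := rfl
  rw [h2, ← Measure.map_map (by fun_prop) (by fun_prop), h, Measure.map_map (by fun_prop) (by fun_prop)]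
  exact Measure.map_id

theorem lintegral_trajLaw_zero (n : ℕ → ℕ+) {f : S × A → ℝ≥0∞} (hf : Measurable f) :
    ∫⁻ ω, f (ω 0) ∂M.trajLaw π n =
      ∫⁻ s, ∫⁻ a, f (s, a) ∂π.act 0 [] (fun j : Fin 0 => j.elim0, s) ∂M.init := by
  rw [← lintegral_map hf (by fun_prop : Measurable fun ω : ℕ → S × A => ω 0), map_zero_trajLaw,
    initLaw, Measure.lintegral_compProd hf]
  rfl

/-- The Ionescu-Tulcea property, with `stepKernel` split into transition and action. All later
computations with `trajLaw` go back to this and to `lintegral_trajLaw_zero`. -/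
theorem lintegral_trajLaw_succ (n : ℕ → ℕ+) (t : ℕ)
    {f : (Fin (t + 1) → S × A) × (S × A) → ℝ≥0∞} (hf : Measurable f) :
    ∫⁻ ω, f (history (t + 1) ω, ω (t + 1)) ∂M.trajLaw π n =
      ∫⁻ ω, ∫⁻ s, ∫⁻ a, f (history (t + 1) ω, (s, a))
        ∂π.act (t + 1) (completedLengths n (t + 1)) (history (t + 1) ω, s)
        ∂M.trans (ω t) ∂M.trajLaw π n := by
  have hr : Measurable fun (x : (Π _ : Finset.Iic t, S × A)) (j : Fin (t + 1)) =>
      x ⟨j, Finset.mem_Iic.2 (Nat.le_of_lt_succ j.2)⟩ := by fun_prop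
  set r := fun (x : (Π _ : Finset.Iic t, S × A)) (j : Fin (t + 1)) =>
      x ⟨j, Finset.mem_Iic.2 (Nat.le_of_lt_succ j.2)⟩
  have hg : Measurable fun y : (Π _ : Finset.Iic t, S × A) × (S × A) => f (r y.1, y.2) := by
    fun_prop
  have key := Kernel.map_frestrictLe_trajMeasure_compProd_eq_map_trajMeasure
    (X := fun _ => S × A) (μ₀ := M.initLaw π) (κ := M.stepKernel π n) (a := t)
  have h1 := congrArg (fun μ => ∫⁻ y, f (r y.1, y.2) ∂μ) key
  beta_reduce at h1
  rw [lintegral_map hg (by fun_prop), Measure.lintegral_compProd hg,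
    lintegral_map (Measurable.lintegral_kernel_prod_right' hg) (by fun_prop)] at h1
  refine h1.symm.trans (lintegral_congr fun ω => ?_)
  rw [stepKernel, Kernel.lintegral_compProd _ _ _ (by fun_prop)]
  rfl

/-- Merges the initial time and the later times into one form, in which the policy is the
conditional law of the action. -/
theorem lintegral_trajLaw_action (n : ℕ → ℕ+) (t : ℕ)
    {f : ((Fin t → S × A) × S) × A → ℝ≥0∞} (hf : Measurable f) :
    ∫⁻ ω, f ((history t ω, (ω t).1), (ω t).2) ∂M.trajLaw π n =
      ∫⁻ ω, ∫⁻ a, f ((history t ω, (ω t).1), a)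
        ∂π.act t (completedLengths n t) (history t ω, (ω t).1) ∂M.trajLaw π n := by
  have hg : Measurable fun x => ∫⁻ a, f (x, a) ∂π.act t (completedLengths n t) x :=
    Measurable.lintegral_kernel_prod_right' hf
  cases t with
  | zero =>
    have hh : ∀ ω : ℕ → S × A, history 0 ω = fun j : Fin 0 => j.elim0 :=
      fun ω => Subsingleton.elim _ _
    simp only [hh]
    rw [M.lintegral_trajLaw_zero π n
        (f := fun y : S × A => f ((fun j : Fin 0 => j.elim0, y.1), y.2)) (by fun_prop),
      M.lintegral_trajLaw_zero π n (f := fun y : S × A => ∫⁻ a, f ((fun j : Fin 0 => j.elim0, y.1), a)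
        ∂π.act 0 (completedLengths n 0) (fun j : Fin 0 => j.elim0, y.1))
        (hg.comp (by fun_prop : Measurable fun y : S × A => ((fun j : Fin 0 => j.elim0 : Fin 0 → S × A), y.1)))]
    simp only [lintegral_const, measure_univ, mul_one]
    rfl
  | succ t =>
    rw [M.lintegral_trajLaw_succ π n t
        (f := fun y => f ((y.1, y.2.1), y.2.2)) (by fun_prop),
      M.lintegral_trajLaw_succ π n t (f := fun y => ∫⁻ a, f ((y.1, y.2.1), a)
        ∂π.act (t + 1) (completedLengths n (t + 1)) (y.1, y.2.1))
        (hg.comp (by fun_prop : Measurable fun y : (Fin (t + 1) → S × A) × (S × A) => (y.1, y.2.1)))]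
    simp only [lintegral_const, measure_univ, mul_one]

theorem lintegral_trajLaw_init (n : ℕ → ℕ+) {f : S → ℝ≥0∞} (hf : Measurable f) :
    ∫⁻ ω, f (ω 0).1 ∂M.trajLaw π n = ∫⁻ s, f s ∂M.init := by
  rw [M.lintegral_trajLaw_zero π n (f := fun y => f y.1) (by fun_prop)]
  simp only [lintegral_const, measure_univ, mul_one]

theorem lintegral_trajLaw_state (n : ℕ → ℕ+) (t : ℕ)
    {f : (Fin (t + 1) → S × A) × S → ℝ≥0∞} (hf : Measurable f) :
    ∫⁻ ω, f (history (t + 1) ω, (ω (t + 1)).1) ∂M.trajLaw π n =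
      ∫⁻ ω, ∫⁻ s, f (history (t + 1) ω, s) ∂M.trans (ω t) ∂M.trajLaw π n := by
  rw [M.lintegral_trajLaw_succ π n t (f := fun y => f (y.1, y.2.1)) (by fun_prop)]
  simp only [lintegral_const, measure_univ, mul_one]

/-- The law of `τ_{0:t}` and `s_t` only depends on the interval lengths that are observed
before time `t`. -/
theorem lintegral_trajLaw_history_congr {n n' : ℕ → ℕ+} (t : ℕ)
    (h : ∀ s < t, completedLengths n s = completedLengths n' s)
    {f : (Fin t → S × A) × S → ℝ≥0∞} (hf : Measurable f) :
    ∫⁻ ω, f (history t ω, (ω t).1) ∂M.trajLaw π n =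
      ∫⁻ ω, f (history t ω, (ω t).1) ∂M.trajLaw π n' := by
  induction t with
  | zero =>
    have hh : ∀ ω : ℕ → S × A, history 0 ω = fun j : Fin 0 => j.elim0 :=
      fun ω => Subsingleton.elim _ _
    simp only [hh]
    rw [M.lintegral_trajLaw_init π n (f := fun s => f (fun j : Fin 0 => j.elim0, s)) (by fun_prop),
      M.lintegral_trajLaw_init π n' (f := fun s => f (fun j : Fin 0 => j.elim0, s)) (by fun_prop)]
  | succ t ih =>
    -- Splitting off the last step allows integrating out the new state and then the action `a_t`;
    -- what remains is a function of `τ_{0:t}` and `s_t`, to which the induction hypothesis applies.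
    have hs : ∀ ω : ℕ → S × A, history (t + 1) ω =
        Fin.snoc (α := fun _ => S × A) (history t ω) ((ω t).1, (ω t).2) := by
      intro ω
      ext j : 1
      refine Fin.lastCases ?_ (fun i => ?_) j <;> simp [history]
    have hsnoc : Measurable fun y : ((Fin t → S × A) × S) × A =>
        (Fin.snoc (α := fun _ => S × A) y.1.1 (y.1.2, y.2) : Fin (t + 1) → S × A) := by
      refine measurable_pi_lambda _ fun j => ?_
      refine Fin.lastCases ?_ (fun i => ?_) j <;> simp <;> fun_prop
    have hF : Measurable fun y : ((Fin t → S × A) × S) × A =>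
        ∫⁻ s, f (Fin.snoc (α := fun _ => S × A) y.1.1 (y.1.2, y.2), s) ∂M.trans (y.1.2, y.2) := by
      have : Measurable fun z : (((Fin t → S × A) × S) × A) × S =>
          f (Fin.snoc (α := fun _ => S × A) z.1.1.1 (z.1.1.2, z.1.2), z.2) :=
        hf.comp ((hsnoc.comp measurable_fst).prodMk measurable_snd)
      exact Measurable.lintegral_kernel_prod_right'
        (κ := M.trans.comap (fun y : ((Fin t → S × A) × S) × A => (y.1.2, y.2)) (by fun_prop)) this
    rw [M.lintegral_trajLaw_state π n t hf, M.lintegral_trajLaw_state π n' t hf]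
    simp only [hs]
    have h1 := M.lintegral_trajLaw_action π n t hF
    have h2 := M.lintegral_trajLaw_action π n' t hF
    simp only [Prod.mk.eta] at h1 h2 ⊢
    rw [h1, h2, h t (Nat.lt_succ_self t)]
    exact ih (fun s hs => h s (hs.trans (Nat.lt_succ_self t)))
      (f := fun x => ∫⁻ a, ∫⁻ s, f (Fin.snoc (α := fun _ => S × A) x.1 (x.2, a), s)
        ∂M.trans (x.2, a) ∂π.act t (completedLengths n' t) x)
      (Measurable.lintegral_kernel_prod_right' hF)

end DRMDP

end Trajectory

/-! ### Combinatorics of interval lengths. -/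

section Lengths

theorem startTime_succ (n : ℕ → ℕ+) (i : ℕ) : startTime n (i + 1) = startTime n i + n i :=
  Finset.sum_range_succ _ _

theorem startTime_strictMono (n : ℕ → ℕ+) : StrictMono (startTime n) :=
  strictMono_nat_of_lt_succ fun i => by
    rw [startTime_succ]; exact Nat.lt_add_of_pos_right (n i).pos

theorem startTime_congr {n n' : ℕ → ℕ+} {i : ℕ} (h : ∀ j < i, n j = n' j) :
    startTime n i = startTime n' i :=
  Finset.sum_congr rfl fun j hj => by rw [h j (Finset.mem_range.1 hj)]

theorem intervalIndex_eq_iff {n : ℕ → ℕ+} {t i : ℕ} :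
    intervalIndex n t = i ↔ startTime n i ≤ t ∧ t < startTime n (i + 1) := by
  -- Intervals have length at least 1, so the search bound `t` in `intervalIndex` excludes nothing.
  have hid : ∀ i, i ≤ startTime n i := (startTime_strictMono n).id_le
  rw [intervalIndex, Nat.findGreatest_eq_iff]
  constructor
  · rintro ⟨h1, h2, h3⟩
    refine ⟨?_, ?_⟩
    · rcases Nat.eq_zero_or_pos i with rfl | h
      · simp [startTime]
      · exact h2 h.ne'
    · by_contra! h
      exact h3 (Nat.lt_succ_self i) ((hid _).trans h) h
  · rintro ⟨h1, h2⟩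
    refine ⟨(hid i).trans h1, fun _ => h1, fun j hj _ h => ?_⟩
    exact absurd (h2.trans_le ((startTime_strictMono n).monotone hj)) (not_lt.2 h)

theorem completedLengths_startTime_add {n : ℕ → ℕ+} {i k : ℕ} (hk : k < n i) :
    completedLengths n (startTime n i + k) = (List.range i).map n := by
  rw [completedLengths, intervalIndex_eq_iff.2 ⟨Nat.le_add_right _ _, _⟩]
  rw [startTime_succ]; omega

/-- Non-anticipation: while the `i`-th interval is still running, neither its length nor any later
one has been observed. -/
theorem completedLengths_congr {n n' : ℕ → ℕ+} {i k t : ℕ} (h : ∀ j < i, n j = n' j)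
    (hk : k < n i) (hk' : k < n' i) (ht : t ≤ startTime n i + k) :
    completedLengths n t = completedLengths n' t := by
  obtain ⟨m, hm⟩ : ∃ m, intervalIndex n t = m := ⟨_, rfl⟩
  have h1 := intervalIndex_eq_iff.1 hm
  have hmi : m ≤ i := by
    have : startTime n m < startTime n (i + 1) := by
      have := startTime_succ n i
      omega
    exact Nat.lt_succ_iff.1 ((startTime_strictMono n).lt_iff_lt.1 this)
  have hm' : intervalIndex n' t = m := by
    rw [intervalIndex_eq_iff, ← startTime_congr fun j hj => h j (hj.trans_le hmi)]
    refine ⟨h1.1, ?_⟩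
    rcases hmi.lt_or_eq with hlt | rfl
    · rw [← startTime_congr fun j hj => h j ((Nat.lt_succ_iff.1 hj).trans_lt hlt)]
      exact h1.2
    · rw [startTime_succ, ← startTime_congr h]; omega
  rw [completedLengths, completedLengths, hm, hm']
  exact List.map_congr_left fun j hj => h j ((List.mem_range.1 hj).trans_le hmi)

theorem duration_map_range (n : ℕ → ℕ+) (i : ℕ) :
    duration ((List.range i).map n) = startTime n i := by
  induction i with
  | zero => simp [duration, startTime]
  | succ i ih => rw [startTime_succ, ← ih]; simp [duration, List.range_succ]

@[simp] theorem duration_nil : duration [] = 0 := rfl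

@[simp] theorem duration_cons (m : ℕ+) (L : List ℕ+) : duration (m :: L) = m + duration L := by
  simp [duration]

@[simp] theorem duration_append (L L' : List ℕ+) :
    duration (L ++ L') = duration L + duration L' := by
  simp [duration]

/-- The sequence of interval lengths that begins with `L` and is constantly `m` afterwards. -/
def extendLengths (L : List ℕ+) (m : ℕ+) : ℕ → ℕ+ := fun j => L.getD j m

theorem map_range_extendLengths (L : List ℕ+) (m : ℕ+) :
    (List.range L.length).map (extendLengths L m) = L := by
  refine List.ext_getElem (by simp) fun j h1 h2 => ?_
  simp [extendLengths, List.getElem?_eq_getElem h2]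

theorem extendLengths_length (L : List ℕ+) (m : ℕ+) : extendLengths L m L.length = m := by
  simp [extendLengths]

theorem startTime_extendLengths (L : List ℕ+) (m : ℕ+) :
    startTime (extendLengths L m) L.length = duration L := by
  rw [← duration_map_range, map_range_extendLengths]

theorem extendLengths_map_range (n : ℕ → ℕ+) (m : ℕ+) {i j : ℕ} (hj : j < i) :
    extendLengths ((List.range i).map n) m j = n j := by
  simp [extendLengths, hj]

end Lengths

/-! ### Segments and how they grow. -/

section Segments

variable {S : Type u} {A : Type v}

/-- The segment of length `c + k` of a history that begins at time `a - c`. -/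
def subsegment (c : ℕ) {t : ℕ} (τ : Fin t → S × A) (a k : ℕ) : Fin (c + k) → Token S A :=
  fun j => if h : c ≤ a + j ∧ a + j - c < t then Sum.inr (τ ⟨a + j - c, h.2⟩) else Sum.inl ()

theorem trajSegment_eq_subsegment (c : ℕ) (ω : ℕ → S × A) {a k t : ℕ} (h : a + k ≤ t) :
    trajSegment c ω a k = subsegment c (history t ω) a k := by
  ext j : 1
  have := j.2
  by_cases h1 : c ≤ a + j
  · have h2 : a + j - c < t := by omega
    simp [trajSegment, subsegment, history, h1, h2]
  · simp [trajSegment, subsegment, h1]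

/-- Append a state-action pair to a segment. -/
def appendStep {m : ℕ} (x : Fin m → Token S A) (s : S) (a : A) : Fin (m + 1) → Token S A :=
  Fin.snoc (α := fun _ => Token S A) x (Sum.inr (s, a))

/-- The last `c` entries of a segment. -/
def overlap {c k : ℕ} (x : Fin (c + k) → Token S A) : Fin (c + 0) → Token S A :=
  fun j => x ⟨k + j, by have := j.2; omega⟩

theorem trajSegment_succ (c : ℕ) (ω : ℕ → S × A) (a k : ℕ) :
    trajSegment c ω a (k + 1) =
      appendStep (trajSegment c ω a k) (ω (a + k)).1 (ω (a + k)).2 := by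
  have key : ∀ j : Fin (c + k + 1), trajSegment c ω a (k + 1) j =
      appendStep (trajSegment c ω a k) (ω (a + k)).1 (ω (a + k)).2 j := by
    intro j
    refine Fin.lastCases ?_ (fun i => ?_) j
    · have h : c ≤ a + (c + k) := by omega
      have h' : a + (c + k) - c = a + k := by omega
      simp [trajSegment, appendStep, h, h']
    · simp [trajSegment, appendStep]
  exact funext key

theorem trajSegment_zero_add (c : ℕ) (ω : ℕ → S × A) (a k : ℕ) :
    trajSegment c ω (a + k) 0 = overlap (trajSegment c ω a k) := by
  ext j : 1
  simp only [trajSegment, overlap]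
  rw [← add_assoc]

theorem trajSegment_zero_zero (c : ℕ) (ω : ℕ → S × A) :
    trajSegment c ω 0 0 = fun _ => Sum.inl () := by
  ext j : 1
  simp [trajSegment]

variable [MeasurableSpace S] [MeasurableSpace A]

@[fun_prop]
theorem measurable_trajSegment (c a k : ℕ) :
    Measurable fun ω : ℕ → S × A => trajSegment c ω a k := by
  refine measurable_pi_lambda _ fun j => ?_
  unfold trajSegment
  split
  · exact measurable_inr.comp (measurable_pi_apply _)
  · exact measurable_const

@[fun_prop]
theorem measurable_subsegment (c t a k : ℕ) :
    Measurable fun τ : Fin t → S × A => subsegment c τ a k := by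
  refine measurable_pi_lambda _ fun j => ?_
  unfold subsegment
  split
  · exact measurable_inr.comp (measurable_pi_apply _)
  · exact measurable_const

@[fun_prop]
theorem Measurable.appendStep {X : Type*} [MeasurableSpace X] {m : ℕ}
    {f : X → Fin m → Token S A} {g : X → S} {h : X → A} (hf : Measurable f) (hg : Measurable g)
    (hh : Measurable h) : Measurable fun x => appendStep (f x) (g x) (h x) := by
  refine measurable_pi_lambda _ fun j => ?_
  refine Fin.lastCases ?_ (fun i => ?_) j
  · simp only [DelayedReward.appendStep, Fin.snoc_last]
    exact measurable_inr.comp (hg.prodMk hh)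
  · simp only [DelayedReward.appendStep, Fin.snoc_castSucc]
    exact (measurable_pi_apply i).comp hf

@[fun_prop]
theorem measurable_overlap {c k : ℕ} :
    Measurable (overlap : (Fin (c + k) → Token S A) → Fin (c + 0) → Token S A) :=
  measurable_pi_lambda _ fun _ => measurable_pi_apply _

end Segments

/-! ### Laws of segments given the completed lengths. -/

namespace DRMDP

variable {S : Type u} {A : Type v} [MeasurableSpace S] [MeasurableSpace A]
variable {c : ℕ} (M : DRMDP c S A) (π : Policy S A)

/-- The law of `((τ_{a-c:a+k}, s_{a+k}), a_{a+k})`, where `a` is the total duration of `L`,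
given that the completed intervals have lengths `L` and the current one is longer than `k`. -/
noncomputable def segmentLaw (L : List ℕ+) (k : ℕ) : Measure (((Fin (c + k) → Token S A) × S) × A) :=
  (M.trajLaw π (extendLengths L k.succPNat)).map fun ω =>
    ((trajSegment c ω (duration L) k, (ω (duration L + k)).1), (ω (duration L + k)).2)

instance (L : List ℕ+) (k : ℕ) : IsProbabilityMeasure (M.segmentLaw π L k) :=
  Measure.isProbabilityMeasure_map (by fun_prop)

theorem lintegral_segmentLaw (L : List ℕ+) (k : ℕ)
    {f : ((Fin (c + k) → Token S A) × S) × A → ℝ≥0∞} (hf : Measurable f) :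
    ∫⁻ y, f y ∂M.segmentLaw π L k = ∫⁻ ω, f ((trajSegment c ω (duration L) k,
      (ω (duration L + k)).1), (ω (duration L + k)).2)
        ∂M.trajLaw π (extendLengths L k.succPNat) :=
  lintegral_map hf (by fun_prop)

/-- The actual lengths from the `i`-th on may be replaced by `k + 1`, because up to offset `k` no
action depends on them. This is where the hidden interval length enters. -/
theorem lintegral_trajLaw_trajSegment (n : ℕ → ℕ+) (i k : ℕ) (hk : k < n i)
    {f : ((Fin (c + k) → Token S A) × S) × A → ℝ≥0∞} (hf : Measurable f) :
    ∫⁻ ω, f ((trajSegment c ω (startTime n i) k, (ω (startTime n i + k)).1),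
        (ω (startTime n i + k)).2) ∂M.trajLaw π n =
      ∫⁻ y, f y ∂M.segmentLaw π ((List.range i).map n) k := by
  set L := (List.range i).map n with hL
  have hLi : L.length = i := by simp [hL]
  have hd : duration L = startTime n i := duration_map_range n i
  set n' := extendLengths L k.succPNat with hn'
  have hk' : k < n' i := by
    rw [hn', ← hLi, extendLengths_length]; simp
  have hnn : ∀ j < i, n j = n' j := fun j hj => (extendLengths_map_range n _ hj).symm
  have hst : startTime n i = startTime n' i := startTime_congr hnn
  have hc : completedLengths n (startTime n i + k) = completedLengths n' (startTime n i + k) :=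
    completedLengths_congr hnn hk hk' le_rfl
  rw [M.lintegral_segmentLaw π L k hf, hd]
  simp only [trajSegment_eq_subsegment c _ (le_refl (startTime n i + k))]
  have hg : Measurable fun y : ((Fin (startTime n i + k) → S × A) × S) × A =>
      f ((subsegment c y.1.1 (startTime n i) k, y.1.2), y.2) := by fun_prop
  have h1 := M.lintegral_trajLaw_action π n _ hg
  have h2 := M.lintegral_trajLaw_action π n' _ hg
  beta_reduce at h1 h2
  rw [h1, h2, ← hc]
  exact M.lintegral_trajLaw_history_congr π _
    (fun s hs => completedLengths_congr hnn hk hk' hs.le)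
    (f := fun x => ∫⁻ a, f ((subsegment c x.1 (startTime n i) k, x.2), a)
      ∂π.act (startTime n i + k) (completedLengths n (startTime n i + k)) x)
    (Measurable.lintegral_kernel_prod_right' hg)

theorem lintegral_segmentLaw_nil_zero {f : (Fin (c + 0) → Token S A) × S → ℝ≥0∞}
    (hf : Measurable f) :
    ∫⁻ y, f y.1 ∂M.segmentLaw π [] 0 = ∫⁻ s, f (fun _ => Sum.inl (), s) ∂M.init := by
  rw [M.lintegral_segmentLaw π [] 0 (f := fun y => f y.1) (by fun_prop)]
  simp only [duration_nil, trajSegment_zero_zero]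
  exact M.lintegral_trajLaw_init π _ (f := fun s => f (fun _ => Sum.inl (), s)) (by fun_prop)

/-- Only `k < n i` is required, so the new state may already belong to the next interval. The same
transition formula therefore serves both for continuing an interval and for ending it. -/
theorem lintegral_trajLaw_next (n : ℕ → ℕ+) (i k : ℕ) (hk : k < n i)
    {f : (Fin (c + (k + 1)) → Token S A) × S → ℝ≥0∞} (hf : Measurable f) :
    ∫⁻ ω, f (trajSegment c ω (startTime n i) (k + 1), (ω (startTime n i + (k + 1))).1)
        ∂M.trajLaw π n =
      ∫⁻ y, ∫⁻ s, f (appendStep y.1.1 y.1.2 y.2, s) ∂M.trans (y.1.2, y.2)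
        ∂M.segmentLaw π ((List.range i).map n) k := by
  have hg : Measurable fun z : (((Fin (c + k) → Token S A) × S) × A) × S =>
      f ((appendStep z.1.1.1 z.1.1.2 z.1.2 : Fin (c + k + 1) → Token S A), z.2) := by
    exact hf.comp ((Measurable.appendStep (by fun_prop) (by fun_prop) (by fun_prop)).prodMk
      measurable_snd)
  have hG : Measurable fun y : ((Fin (c + k) → Token S A) × S) × A =>
      ∫⁻ s, f (appendStep y.1.1 y.1.2 y.2, s) ∂M.trans (y.1.2, y.2) :=
    Measurable.lintegral_kernel_prod_right'
      (κ := M.trans.comap (fun y : ((Fin (c + k) → Token S A) × S) × A => (y.1.2, y.2))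
        (by fun_prop)) hg
  rw [← M.lintegral_trajLaw_trajSegment π n i k hk hG]
  simp only [Prod.mk.eta]
  simp only [← trajSegment_succ]
  simp only [trajSegment_eq_subsegment c _ (le_refl (startTime n i + (k + 1)))]
  exact M.lintegral_trajLaw_state π n (startTime n i + k)
    (f := fun x => f (subsegment c x.1 (startTime n i) (k + 1), x.2)) (by fun_prop)

theorem lintegral_segmentLaw_succ (L : List ℕ+) (k : ℕ)
    {f : (Fin (c + (k + 1)) → Token S A) × S → ℝ≥0∞} (hf : Measurable f) :
    ∫⁻ y, f y.1 ∂M.segmentLaw π L (k + 1) =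
      ∫⁻ y, ∫⁻ s, f (appendStep y.1.1 y.1.2 y.2, s) ∂M.trans (y.1.2, y.2)
        ∂M.segmentLaw π L k := by
  rw [M.lintegral_segmentLaw π L (k + 1) (f := fun y => f y.1) (by fun_prop)]
  have h := M.lintegral_trajLaw_next π (extendLengths L (k + 1).succPNat) L.length k
    (by rw [extendLengths_length]; simp) hf
  rwa [map_range_extendLengths, startTime_extendLengths] at h

theorem lintegral_segmentLaw_concat_zero (L : List ℕ+) (k : ℕ)
    {f : (Fin (c + 0) → Token S A) × S → ℝ≥0∞} (hf : Measurable f) :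
    ∫⁻ y, f y.1 ∂M.segmentLaw π (L ++ [k.succPNat]) 0 =
      ∫⁻ y, ∫⁻ s, f (overlap (k := k + 1) (appendStep y.1.1 y.1.2 y.2), s)
        ∂M.trans (y.1.2, y.2) ∂M.segmentLaw π L k := by
  rw [M.lintegral_segmentLaw π _ 0 (f := fun y => f y.1) (by fun_prop)]
  -- Under these lengths the interval after `L` has length exactly `k + 1`, so the segment at offset
  -- 0 of the following one is the overlap of the extended segment.
  set n := extendLengths (L ++ [k.succPNat]) (0 : ℕ).succPNat with hn
  have hL : (List.range L.length).map n = L := by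
    refine List.ext_getElem (by simp) fun j h1 h2 => ?_
    simp [hn, extendLengths, List.getElem?_append_left h2, List.getElem?_eq_getElem h2]
  have hnL : n L.length = k.succPNat := by simp [hn, extendLengths, List.getD]
  have h := M.lintegral_trajLaw_next π n L.length k (by rw [hnL]; simp)
    (f := fun x => f (overlap x.1, x.2)) (by fun_prop)
  rw [hL] at h
  rw [← h, ← duration_map_range, hL]
  simp only [duration_append, duration_cons, duration_nil, Nat.succPNat_coe, Nat.succ_eq_add_one,
    add_zero, trajSegment_zero_add]

theorem act_eq_of_forall {σ : (k : ℕ) → Kernel ((Fin (c + k) → Token S A) × S) A}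
    (hσ : ∀ (t : ℕ) (L : List ℕ+), duration L ≤ t → ∀ (τ : Fin t → S × A) (s : S),
      π.act t L (τ, s) = σ (t - duration L) (historySegment c τ (duration L), s))
    (L : List ℕ+) (k : ℕ) (τ : Fin (duration L + k) → S × A) (s : S) :
    π.act (duration L + k) L (τ, s) = σ k (subsegment c τ (duration L) k, s) := by
  rw [hσ _ _ (Nat.le_add_right _ _)]
  -- The offset `duration L + k - duration L` occurs in the types, so it is generalized before being
  -- replaced by `k`.
  have : ∀ k' : ℕ, k' = k → σ k' (subsegment c τ (duration L) k', s) =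
      σ k (subsegment c τ (duration L) k, s) := by rintro _ rfl; rfl
  exact this _ (Nat.add_sub_cancel_left _ _)

/-- The conditional action law is the same `σ k` for every `L`; this is why the disintegration
survives the summation over `L`. -/
theorem lintegral_segmentLaw_of_isTau {σ : (k : ℕ) → Kernel ((Fin (c + k) → Token S A) × S) A}
    (hσ : ∀ (t : ℕ) (L : List ℕ+), duration L ≤ t → ∀ (τ : Fin t → S × A) (s : S),
      π.act t L (τ, s) = σ (t - duration L) (historySegment c τ (duration L), s))
    (hm : ∀ k, IsMarkovKernel (σ k)) (L : List ℕ+) (k : ℕ)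
    {f : ((Fin (c + k) → Token S A) × S) × A → ℝ≥0∞} (hf : Measurable f) :
    ∫⁻ y, f y ∂M.segmentLaw π L k =
      ∫⁻ y, ∫⁻ a, f (y.1, a) ∂σ k y.1 ∂M.segmentLaw π L k := by
  have hG : Measurable fun x : (Fin (c + k) → Token S A) × S => ∫⁻ a, f (x, a) ∂σ k x :=
    Measurable.lintegral_kernel_prod_right' hf
  rw [M.lintegral_segmentLaw π L k hf, M.lintegral_segmentLaw π L k (f := fun y => ∫⁻ a, f (y.1, a) ∂σ k y.1)
    (hG.comp measurable_fst)]
  simp only [trajSegment_eq_subsegment c _ (le_refl (duration L + k))]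
  have hg : Measurable fun y : ((Fin (duration L + k) → S × A) × S) × A =>
      f ((subsegment c y.1.1 (duration L) k, y.1.2), y.2) := by fun_prop
  have h1 := M.lintegral_trajLaw_action π (extendLengths L k.succPNat) _ hg
  have h2 : completedLengths (extendLengths L k.succPNat) (duration L + k) = L := by
    have := completedLengths_startTime_add (n := extendLengths L k.succPNat) (i := L.length)
      (k := k) (by rw [extendLengths_length]; simp)
    rwa [startTime_extendLengths, map_range_extendLengths] at this
  beta_reduce at h1
  rw [h1, h2]
  simp only [act_eq_of_forall π hσ]

end DRMDP

/-! ### Discounted occupation measures and their flow equations. -/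

theorem tsum_list_eq_add_tsum_concat {α : Type*} (F : List α → ℝ≥0∞) :
    ∑' L, F L = F [] + ∑' m, ∑' L, F (L ++ [m]) := by
  classical
  have hinj : Function.Injective fun p : α × List α => p.2 ++ [p.1] := by
    rintro ⟨m, L⟩ ⟨m', L'⟩ h
    obtain ⟨h1, h2⟩ := List.append_inj' h rfl
    simp_all
  rw [ENNReal.tsum_eq_add_tsum_ite [], ← ENNReal.tsum_prod (f := fun m L => F (L ++ [m])),
    ← hinj.tsum_eq]
  · simp
  · intro L hL
    rcases List.eq_nil_or_concat L with rfl | ⟨L', m, rfl⟩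
    · simp at hL
    · exact ⟨(m, L'), by simp⟩

namespace DRMDP

variable {S : Type u} {A : Type v} [MeasurableSpace S] [MeasurableSpace A]
variable {c : ℕ} (M : DRMDP c S A) (π : Policy S A)

/-- The discounted probability `q_n(m) γ ^ m` of an interval of length `m`. -/
noncomputable def lengthWeight (m : ℕ+) : ℝ≥0∞ :=
  M.lengthLaw m * ENNReal.ofReal (M.discount ^ (m : ℕ))

/-- The discounted probability that the first intervals have lengths `L`. -/
noncomputable def listWeight (L : List ℕ+) : ℝ≥0∞ := (L.map M.lengthWeight).prod

/-- Lengths are positive, so `γ ^ m ≤ γ`. This is the contraction factor per interval. -/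
theorem tsum_lengthWeight_le : ∑' m, M.lengthWeight m ≤ ENNReal.ofReal M.discount := by
  calc ∑' m, M.lengthWeight m ≤ ∑' m, M.lengthLaw m * ENNReal.ofReal M.discount := by
        refine ENNReal.tsum_le_tsum fun m => ?_
        refine mul_le_mul_right (ENNReal.ofReal_le_ofReal ?_) _
        exact pow_le_of_le_one M.discount_nonneg M.discount_lt_one.le m.pos.ne'
    _ = ENNReal.ofReal M.discount := by rw [ENNReal.tsum_mul_right, M.lengthLaw.tsum_coe, one_mul]

@[simp] theorem listWeight_nil : M.listWeight [] = 1 := rfl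

theorem listWeight_concat (L : List ℕ+) (m : ℕ+) :
    M.listWeight (L ++ [m]) = M.listWeight L * M.lengthWeight m := by
  simp [listWeight]

theorem tsum_listWeight_ne_top : ∑' L, M.listWeight L ≠ ∞ := by
  have hγ : 0 < 1 - M.discount := sub_pos.2 M.discount_lt_one
  -- `C` is the sum of the geometric series. The equation `1 + γ C = C` makes it an invariant bound
  -- for the sums over lists of length less than `N`.
  set C : ℝ≥0∞ := ENNReal.ofReal (1 / (1 - M.discount)) with hC
  have hC1 : 1 + ENNReal.ofReal M.discount * C = C := by
    rw [hC, ← ENNReal.ofReal_mul M.discount_nonneg, ← ENNReal.ofReal_one,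
      ← ENNReal.ofReal_add zero_le_one (by have := M.discount_nonneg; positivity)]
    congr 1
    field_simp
    ring
  have hN : ∀ N : ℕ, ∑' L : List ℕ+, (if L.length < N then M.listWeight L else 0) ≤ C := by
    intro N
    induction N with
    | zero => simp
    | succ N ih =>
      rw [tsum_list_eq_add_tsum_concat]
      have h : ∀ (m : ℕ+) (L : List ℕ+),
          (if (L ++ [m]).length < N + 1 then M.listWeight (L ++ [m]) else 0) =
            (if L.length < N then M.listWeight L else 0) * M.lengthWeight m := by
        intro m L
        simp only [List.length_append, List.length_singleton, Nat.add_lt_add_iff_right]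
        split_ifs
        · exact M.listWeight_concat L m
        · simp
      simp only [h, ENNReal.tsum_mul_right, ENNReal.tsum_mul_left]
      rw [← hC1]
      refine add_le_add (by simp) ?_
      rw [mul_comm]
      exact mul_le_mul' M.tsum_lengthWeight_le ih
  refine ne_top_of_le_ne_top (ENNReal.ofReal_ne_top : C ≠ ∞) ?_
  rw [ENNReal.tsum_eq_iSup_sum]
  refine iSup_le fun s => le_trans ?_ (hN (s.sup List.length + 1))
  refine le_trans (Finset.sum_le_sum fun L hL => ?_) (ENNReal.sum_le_tsum s)
  rw [if_pos (Nat.lt_succ_of_le (Finset.le_sup (f := List.length) hL))]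

/-- The discounted occupation measure of `((τ_{t_i-c:t_i+k}, s_{t_i+k}), a_{t_i+k})`, summed over
all intervals `i`, where the process is continued in each interval as if it would never end. -/
noncomputable def occupation (k : ℕ) : Measure (((Fin (c + k) → Token S A) × S) × A) :=
  Measure.sum fun L => M.listWeight L • M.segmentLaw π L k

theorem lintegral_occupation (k : ℕ) (f : ((Fin (c + k) → Token S A) × S) × A → ℝ≥0∞) :
    ∫⁻ y, f y ∂M.occupation π k = ∑' L, M.listWeight L * ∫⁻ y, f y ∂M.segmentLaw π L k := by
  simp [occupation, lintegral_sum_measure, lintegral_smul_measure]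

instance (k : ℕ) : IsFiniteMeasure (M.occupation π k) := by
  refine ⟨lt_top_iff_ne_top.2 ?_⟩
  rw [← lintegral_one, lintegral_occupation]
  simpa using M.tsum_listWeight_ne_top

/-- The expectation of a nonnegative function of the extended segment and the next state. -/
noncomputable def stepForward {k : ℕ} (f : (Fin (c + (k + 1)) → Token S A) × S → ℝ≥0∞)
    (y : ((Fin (c + k) → Token S A) × S) × A) : ℝ≥0∞ :=
  ∫⁻ s, f (appendStep y.1.1 y.1.2 y.2, s) ∂M.trans (y.1.2, y.2)

theorem measurable_stepForward {k : ℕ} {f : (Fin (c + (k + 1)) → Token S A) × S → ℝ≥0∞}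
    (hf : Measurable f) : Measurable (M.stepForward f) := by
  have hg : Measurable fun z : (((Fin (c + k) → Token S A) × S) × A) × S =>
      f ((appendStep z.1.1.1 z.1.1.2 z.1.2 : Fin (c + k + 1) → Token S A), z.2) :=
    hf.comp ((Measurable.appendStep (by fun_prop) (by fun_prop) (by fun_prop)).prodMk
      measurable_snd)
  exact Measurable.lintegral_kernel_prod_right'
      (κ := M.trans.comap (fun y : ((Fin (c + k) → Token S A) × S) × A => (y.1.2, y.2))
        (by fun_prop)) hg

/-- The flow equations of discounted occupation measures. -/
structure IsFlow (μ : (k : ℕ) → Measure (((Fin (c + k) → Token S A) × S) × A)) : Prop where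
  isFiniteMeasure : ∀ k, IsFiniteMeasure (μ k)
  lintegral_zero : ∀ f : (Fin (c + 0) → Token S A) × S → ℝ≥0∞, Measurable f →
    ∫⁻ y, f y.1 ∂μ 0 = ∫⁻ s, f (fun _ => Sum.inl (), s) ∂M.init +
      ∑' k : ℕ, M.lengthWeight k.succPNat *
        ∫⁻ y, M.stepForward (fun x => f (overlap x.1, x.2)) y ∂μ k
  lintegral_succ : ∀ (k : ℕ) (f : (Fin (c + (k + 1)) → Token S A) × S → ℝ≥0∞), Measurable f →
    ∫⁻ y, f y.1 ∂μ (k + 1) = ∫⁻ y, M.stepForward f y ∂μ k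

theorem tsum_pnat_eq_tsum_succPNat {α : Type*} [AddCommMonoid α] [TopologicalSpace α]
    (f : ℕ+ → α) : ∑' m, f m = ∑' k : ℕ, f k.succPNat :=
  (Equiv.pnatEquivNat.symm.tsum_eq f).symm

/-- At offset 0 the empty list contributes the initial law; any other list is split into its last
interval, of length `k + 1`, and the intervals before it. -/
theorem isFlow_occupation : M.IsFlow (M.occupation π) where
  isFiniteMeasure k := inferInstance
  lintegral_zero f hf := by
    rw [lintegral_occupation, tsum_list_eq_add_tsum_concat, listWeight_nil, one_mul,
      M.lintegral_segmentLaw_nil_zero π hf, tsum_pnat_eq_tsum_succPNat]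
    congr 1
    refine tsum_congr fun k => ?_
    rw [lintegral_occupation, ← ENNReal.tsum_mul_left]
    refine tsum_congr fun L => ?_
    rw [M.lintegral_segmentLaw_concat_zero π L k hf, listWeight_concat,
      mul_comm (M.listWeight L), mul_assoc]
    rfl
  lintegral_succ k f hf := by
    rw [lintegral_occupation, lintegral_occupation]
    exact tsum_congr fun L => by rw [M.lintegral_segmentLaw_succ π L k hf]; rfl

theorem lintegral_occupation_of_isTau
    {σ : (k : ℕ) → Kernel ((Fin (c + k) → Token S A) × S) A}
    (hσ : ∀ (t : ℕ) (L : List ℕ+), duration L ≤ t → ∀ (τ : Fin t → S × A) (s : S),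
      π.act t L (τ, s) = σ (t - duration L) (historySegment c τ (duration L), s))
    (hm : ∀ k, IsMarkovKernel (σ k)) (k : ℕ)
    {f : ((Fin (c + k) → Token S A) × S) × A → ℝ≥0∞} (hf : Measurable f) :
    ∫⁻ y, f y ∂M.occupation π k = ∫⁻ y, ∫⁻ a, f (y.1, a) ∂σ k y.1 ∂M.occupation π k := by
  rw [lintegral_occupation, lintegral_occupation]
  exact tsum_congr fun L => by rw [M.lintegral_segmentLaw_of_isTau π hσ hm L k hf]

end DRMDP

/-! ### The value as a linear functional of the occupation measures. -/

instance : DiscreteMeasurableSpace ℕ+ := ⟨fun _ => trivial⟩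

namespace DRMDP

variable {S : Type u} {A : Type v} [MeasurableSpace S] [MeasurableSpace A]
variable {c : ℕ} (M : DRMDP c S A) (π : Policy S A)

instance : IsProbabilityMeasure M.lengthsLaw := by
  unfold lengthsLaw; infer_instance

/-- The supremum of the absolute values of the rewards of intervals of length `m`. -/
noncomputable def rewardBound (m : ℕ+) : ℝ≥0∞ := ⨆ τ, ‖M.reward m τ‖ₑ

theorem tsum_rewardBound_ne_top :
    ∑' k : ℕ, M.lengthLaw k.succPNat * ENNReal.ofReal (M.discount ^ k) *
      M.rewardBound k.succPNat ≠ ∞ := by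
  obtain ⟨B, hB, hs⟩ := M.summable_reward
  refine ne_top_of_le_ne_top hs.tsum_ofReal_ne_top ?_
  rw [tsum_pnat_eq_tsum_succPNat]
  refine ENNReal.tsum_le_tsum fun k => ?_
  by_cases h : k.succPNat ∈ M.lengthLaw.support
  · have h1 : M.rewardBound k.succPNat ≤ ENNReal.ofReal (B k.succPNat) := by
      refine iSup_le fun τ => ?_
      rw [Real.enorm_eq_ofReal_abs]
      exact ENNReal.ofReal_le_ofReal (hB _ h τ)
    have hγ := pow_nonneg M.discount_nonneg k
    rw [ENNReal.ofReal_mul (by simpa using by positivity),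
      ENNReal.ofReal_mul ENNReal.toReal_nonneg, ENNReal.ofReal_toReal (M.lengthLaw.apply_ne_top _)]
    simp only [Nat.succPNat_coe, Nat.succ_sub_one]
    gcongr
  -- Off the support `rewardBound` may be infinite, but it is multiplied by probability 0.
  · rw [PMF.mem_support_iff, not_not] at h
    simp [h]

/-- The event that `p.1` are the lengths of the first intervals and that the next one has length
`p.2 + 1`. -/
def IsPrefix (p : List ℕ+ × ℕ) : Set (ℕ → ℕ+) :=
  {n | (List.range p.1.length).map n = p.1 ∧ n p.1.length = p.2.succPNat}

/-- As a cylinder over finitely many coordinates, the event is measurable and its probability is a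
product. -/
theorem isPrefix_eq_pi (p : List ℕ+ × ℕ) :
    IsPrefix p = Set.pi (Finset.range (p.1.length + 1) : Set ℕ)
      fun j => {extendLengths p.1 p.2.succPNat j} := by
  ext n
  simp only [IsPrefix, Set.mem_ofPred_eq, Set.mem_pi, Set.mem_singleton_iff, Finset.coe_range,
    Set.mem_Iio, Nat.lt_succ_iff_lt_or_eq]
  constructor
  · rintro ⟨h1, h2⟩ j (hj | rfl)
    · conv_rhs => rw [← h1]
      rw [extendLengths_map_range n _ hj]
    · rw [h2, extendLengths_length]
  · intro h
    refine ⟨?_, ?_⟩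
    · conv_rhs => rw [← map_range_extendLengths p.1 p.2.succPNat]
      exact List.map_congr_left fun j hj => h j (Or.inl (List.mem_range.1 hj))
    · rw [h _ (Or.inr rfl), extendLengths_length]

theorem measurableSet_isPrefix (p : List ℕ+ × ℕ) : MeasurableSet (IsPrefix p) := by
  rw [isPrefix_eq_pi]
  exact MeasurableSet.pi (Finset.countable_toSet _) fun _ _ => .of_discrete

theorem prod_map_range {N : Type*} [CommMonoid N] (f : ℕ → N) (i : ℕ) :
    ((List.range i).map f).prod = ∏ j ∈ Finset.range i, f j := by
  induction i with
  | zero => simp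
  | succ i ih => simp [List.range_succ, Finset.prod_range_succ, ih]

theorem lengthsLaw_isPrefix (p : List ℕ+ × ℕ) :
    M.lengthsLaw (IsPrefix p) = (p.1.map M.lengthLaw).prod * M.lengthLaw p.2.succPNat := by
  rw [isPrefix_eq_pi, lengthsLaw, Measure.infinitePi_pi _ fun _ _ => .of_discrete]
  simp only [PMF.toMeasure_apply_singleton _ _ (MeasurableSet.of_discrete)]
  rw [Finset.prod_range_succ, extendLengths_length, ← prod_map_range]
  congr 2
  conv_rhs => rw [← map_range_extendLengths p.1 p.2.succPNat]
  simp

theorem listWeight_eq (L : List ℕ+) :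
    M.listWeight L = (L.map M.lengthLaw).prod * ENNReal.ofReal (M.discount ^ duration L) := by
  induction L with
  | nil => simp
  | cons m L ih =>
    have h : M.listWeight (m :: L) = M.lengthWeight m * M.listWeight L := by simp [listWeight]
    rw [h, ih, lengthWeight, duration_cons, pow_add,
      ENNReal.ofReal_mul (pow_nonneg M.discount_nonneg _)]
    simp only [List.map_cons, List.prod_cons]
    ring

/-- The completed intervals and the length of the `i`-th interval, as a prefix. -/
def prefixOf (n : ℕ → ℕ+) (i : ℕ) : List ℕ+ × ℕ := ((List.range i).map n, (n i).natPred)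

/-- The prefixes realized by `n` are exactly the `prefixOf n i`, one for each interval. This turns a
sum with random terms into a sum over a fixed countable set of events. -/
theorem tsum_prefixOf {α : Type*} [AddCommMonoid α] [TopologicalSpace α] [T2Space α]
    (n : ℕ → ℕ+) (G : List ℕ+ × ℕ → α) :
    ∑' i, G (prefixOf n i) = ∑' p, (IsPrefix p).indicator (fun _ => G p) n := by
  have hinj : Function.Injective (prefixOf n) := fun i j h => by
    simpa [prefixOf] using congrArg (fun p : List ℕ+ × ℕ => p.1.length) h
  have hmem : ∀ i, n ∈ IsPrefix (prefixOf n i) := fun i => by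
    simp [IsPrefix, prefixOf]
  rw [← hinj.tsum_eq]
  · exact tsum_congr fun i => by rw [Set.indicator_of_mem (hmem i)]
  · intro p hp
    have h : n ∈ IsPrefix p := by
      by_contra h
      exact hp (Set.indicator_of_notMem h _)
    refine ⟨p.1.length, Prod.ext h.1 ?_⟩
    simp [prefixOf, h.2]

theorem map_trajLaw_trajSegment (n : ℕ → ℕ+) (i k : ℕ) (hk : k < n i) :
    (M.trajLaw π n).map (fun ω => ((trajSegment c ω (startTime n i) k,
        (ω (startTime n i + k)).1), (ω (startTime n i + k)).2)) =
      M.segmentLaw π ((List.range i).map n) k := by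
  refine Measure.ext_of_lintegral _ fun f hf => ?_
  rw [lintegral_map hf (by fun_prop)]
  exact M.lintegral_trajLaw_trajSegment π n i k hk hf

/-- The reward of an interval of length `k + 1` in terms of its last step. -/
def lastReward (k : ℕ) (y : ((Fin (c + k) → Token S A) × S) × A) : ℝ :=
  M.reward k.succPNat (appendStep y.1.1 y.1.2 y.2 : Fin (c + k + 1) → Token S A)

@[fun_prop]
theorem measurable_lastReward (k : ℕ) : Measurable (M.lastReward k) := by
  have h : Measurable fun y : ((Fin (c + k) → Token S A) × S) × A =>
      (appendStep y.1.1 y.1.2 y.2 : Fin (c + k + 1) → Token S A) :=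
    Measurable.appendStep (by fun_prop) (by fun_prop) (by fun_prop)
  exact (M.measurable_reward k.succPNat).comp h

theorem enorm_lastReward_le (k : ℕ) (y : ((Fin (c + k) → Token S A) × S) × A) :
    ‖M.lastReward k y‖ₑ ≤ M.rewardBound k.succPNat :=
  le_iSup (fun τ => ‖M.reward k.succPNat τ‖ₑ) _

theorem reward_trajSegment {m : ℕ+} {k : ℕ} (h : m = k.succPNat) (ω : ℕ → S × A) (a : ℕ) :
    M.reward m (trajSegment c ω a m) =
      M.lastReward k ((trajSegment c ω a k, (ω (a + k)).1), (ω (a + k)).2) := by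
  subst h
  exact congrArg (M.reward k.succPNat) (trajSegment_succ c ω a k)

/-- The contribution of a prefix to the expected return. -/
noncomputable def prefixReturn (p : List ℕ+ × ℕ) : ℝ :=
  M.discount ^ duration p.1 * M.discount ^ p.2 * ∫ y, M.lastReward p.2 y ∂M.segmentLaw π p.1 p.2

/-- A bound for the contribution of a prefix to the expected return. -/
noncomputable def prefixBound (p : List ℕ+ × ℕ) : ℝ≥0∞ :=
  ENNReal.ofReal (M.discount ^ duration p.1) * ENNReal.ofReal (M.discount ^ p.2) *
    M.rewardBound p.2.succPNat

theorem tsum_lengthsLaw_mul_prefixBound_ne_top :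
    ∑' p, M.lengthsLaw (IsPrefix p) * M.prefixBound p ≠ ∞ := by
  have h : ∀ (L : List ℕ+) (k : ℕ), M.lengthsLaw (IsPrefix (L, k)) * M.prefixBound (L, k) =
      M.listWeight L * (M.lengthLaw k.succPNat * ENNReal.ofReal (M.discount ^ k) *
        M.rewardBound k.succPNat) := by
    intro L k
    rw [lengthsLaw_isPrefix, prefixBound, listWeight_eq]
    ring
  rw [ENNReal.tsum_prod']
  simp only [h, ENNReal.tsum_mul_left, ENNReal.tsum_mul_right]
  exact ENNReal.mul_ne_top M.tsum_listWeight_ne_top M.tsum_rewardBound_ne_top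

theorem ae_tsum_prefixBound_ne_top :
    ∀ᵐ n ∂M.lengthsLaw, ∑' i, M.prefixBound (prefixOf n i) ≠ ∞ := by
  simp only [tsum_prefixOf]
  have hm : ∀ p, Measurable ((IsPrefix p).indicator fun _ => M.prefixBound p) := fun p =>
    measurable_const.indicator (measurableSet_isPrefix p)
  refine (ae_lt_top (Measurable.tsum hm) ?_).mono fun n h => h.ne
  rw [lintegral_tsum fun p => (hm p).aemeasurable]
  simpa [lintegral_indicator_const (measurableSet_isPrefix _), mul_comm]
    using M.tsum_lengthsLaw_mul_prefixBound_ne_top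

theorem prefixReturn_prefixOf (n : ℕ → ℕ+) (i : ℕ) :
    ∫ ω, M.discount ^ (startTime n (i + 1) - 1) *
        M.reward (n i) (trajSegment c ω (startTime n i) (n i)) ∂M.trajLaw π n =
      M.prefixReturn π (prefixOf n i) ∧
    ∫⁻ ω, ‖M.discount ^ (startTime n (i + 1) - 1) *
        M.reward (n i) (trajSegment c ω (startTime n i) (n i))‖ₑ ∂M.trajLaw π n ≤
      M.prefixBound (prefixOf n i) := by
  obtain ⟨k, hk⟩ : ∃ k : ℕ, n i = k.succPNat := ⟨(n i).natPred, by simp⟩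
  have hp : prefixOf n i = ((List.range i).map n, k) := by simp [prefixOf, hk]
  -- The reward arrives at the last step of the interval: `t_{i+1} - 1 = t_i + k`, as `n i = k + 1`.
  have he : M.discount ^ (startTime n (i + 1) - 1) =
      M.discount ^ duration ((List.range i).map n) * M.discount ^ k := by
    rw [duration_map_range, startTime_succ, hk, ← pow_add]; congr 1
  simp only [M.reward_trajSegment hk, he, hp]
  constructor
  · rw [prefixReturn, ← M.map_trajLaw_trajSegment π n i k (by simp [hk]),
      integral_map (by fun_prop) (M.measurable_lastReward k).aestronglyMeasurable,
      integral_const_mul]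
  · refine (lintegral_mono (g := fun _ => M.prefixBound ((List.range i).map n, k))
      fun ω => ?_).trans (by simp)
    simp only [enorm_mul, prefixBound]
    refine mul_le_mul' (le_of_eq ?_) (M.enorm_lastReward_le k _)
    rw [Real.enorm_of_nonneg (pow_nonneg M.discount_nonneg _),
      Real.enorm_of_nonneg (pow_nonneg M.discount_nonneg _)]

theorem integral_discountedReturn {n : ℕ → ℕ+} (h : ∑' i, M.prefixBound (prefixOf n i) ≠ ∞) :
    ∫ ω, M.discountedReturn n ω ∂M.trajLaw π n = ∑' i, M.prefixReturn π (prefixOf n i) := by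
  unfold discountedReturn
  rw [integral_tsum]
  · exact tsum_congr fun i => (M.prefixReturn_prefixOf π n i).1
  · intro i
    have := M.measurable_reward (n i)
    exact (measurable_const.mul (this.comp (by fun_prop))).aestronglyMeasurable
  · exact ne_top_of_le_ne_top h
      (ENNReal.tsum_le_tsum fun i => (M.prefixReturn_prefixOf π n i).2)

theorem enorm_prefixReturn_le (p : List ℕ+ × ℕ) :
    ‖M.prefixReturn π p‖ₑ ≤ M.prefixBound p := by
  rw [prefixReturn, enorm_mul, enorm_mul, prefixBound,
    Real.enorm_of_nonneg (pow_nonneg M.discount_nonneg _),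
    Real.enorm_of_nonneg (pow_nonneg M.discount_nonneg _)]
  gcongr
  refine (enorm_integral_le_lintegral_enorm _).trans
    ((lintegral_mono (M.enorm_lastReward_le p.2)).trans (by simp))

/-- Sum and integral are exchanged twice: over trajectories for almost every `n`, where the bounds
are summable, and then over the lengths. -/
theorem value_eq_tsum_prefix :
    M.value π = ∑' p, (M.lengthsLaw (IsPrefix p)).toReal * M.prefixReturn π p := by
  have h1 : M.value π = ∫ n, ∑' p, (IsPrefix p).indicator (fun _ => M.prefixReturn π p) n
      ∂M.lengthsLaw := by
    refine integral_congr_ae (M.ae_tsum_prefixBound_ne_top.mono fun n hn => ?_)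
    beta_reduce
    rw [M.integral_discountedReturn π hn, tsum_prefixOf]
  have hm : ∀ p, Measurable ((IsPrefix p).indicator fun _ => M.prefixReturn π p) := fun p =>
    measurable_const.indicator (measurableSet_isPrefix p)
  rw [h1, integral_tsum fun p => (hm p).aestronglyMeasurable]
  · refine tsum_congr fun p => ?_
    rw [integral_indicator_const _ (measurableSet_isPrefix p), smul_eq_mul]
    rfl
  · refine ne_top_of_le_ne_top M.tsum_lengthsLaw_mul_prefixBound_ne_top
      (ENNReal.tsum_le_tsum fun p => ?_)
    simp only [enorm_indicator_eq_indicator_enorm]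
    rw [lintegral_indicator_const (measurableSet_isPrefix p), mul_comm]
    gcongr
    exact M.enorm_prefixReturn_le π p

/-- The reward of an interval of length `k + 1`, weighted by the probability of this length and
the discount factor. -/
noncomputable def weightedReward (k : ℕ) (y : ((Fin (c + k) → Token S A) × S) × A) : ℝ :=
  (M.lengthLaw k.succPNat).toReal * M.discount ^ k * M.lastReward k y

@[fun_prop]
theorem measurable_weightedReward (k : ℕ) : Measurable (M.weightedReward k) := by
  unfold weightedReward; fun_prop

theorem enorm_weightedReward_le (k : ℕ) (y : ((Fin (c + k) → Token S A) × S) × A) :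
    ‖M.weightedReward k y‖ₑ ≤ M.lengthLaw k.succPNat * ENNReal.ofReal (M.discount ^ k) *
      M.rewardBound k.succPNat := by
  rw [weightedReward, enorm_mul, enorm_mul, Real.enorm_of_nonneg ENNReal.toReal_nonneg,
    ENNReal.ofReal_toReal (M.lengthLaw.apply_ne_top _),
    Real.enorm_of_nonneg (pow_nonneg M.discount_nonneg _)]
  gcongr
  exact M.enorm_lastReward_le k y

theorem exists_summable_abs_weightedReward_le :
    ∃ β : ℕ → ℝ, Summable β ∧ ∀ k y, |M.weightedReward k y| ≤ β k := by
  refine ⟨_, ENNReal.summable_toReal M.tsum_rewardBound_ne_top, fun k y => ?_⟩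
  have h := M.enorm_weightedReward_le k y
  rw [Real.enorm_eq_ofReal_abs] at h
  exact (ENNReal.ofReal_le_iff_le_toReal
    (ENNReal.ne_top_of_tsum_ne_top M.tsum_rewardBound_ne_top k)).1 h

theorem integrable_weightedReward (k : ℕ) (μ : Measure (((Fin (c + k) → Token S A) × S) × A))
    [IsFiniteMeasure μ] : Integrable (M.weightedReward k) μ := by
  obtain ⟨β, -, hβ⟩ := M.exists_summable_abs_weightedReward_le
  exact Integrable.of_bound (M.measurable_weightedReward k).aestronglyMeasurable (β k)
    (ae_of_all _ (hβ k))

/-- The probability of a prefix `(L, k)` times its discount factors into `listWeight L` and the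
weight of length `k + 1`. Grouping the prefixes by `k` therefore assembles the occupation measure at
offset `k`. -/
theorem value_eq_tsum_occupation :
    M.value π = ∑' k, ∫ y, M.weightedReward k y ∂M.occupation π k := by
  have hint : ∀ k, ∫ y, M.weightedReward k y ∂M.occupation π k =
      ∑' L, (M.lengthsLaw (IsPrefix (L, k))).toReal * M.prefixReturn π (L, k) := by
    intro k
    have hi := M.integrable_weightedReward k (M.occupation π k)
    rw [occupation] at hi ⊢
    rw [integral_sum_measure hi]
    refine tsum_congr fun L => ?_
    rw [integral_smul_measure, lengthsLaw_isPrefix, listWeight_eq, prefixReturn]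
    simp only [weightedReward]
    rw [integral_const_mul, smul_eq_mul, ENNReal.toReal_mul, ENNReal.toReal_mul,
      ENNReal.toReal_ofReal (pow_nonneg M.discount_nonneg _)]
    ring
  have hs : Summable fun p : List ℕ+ × ℕ =>
      (M.lengthsLaw (IsPrefix p)).toReal * M.prefixReturn π p := by
    refine Summable.of_norm_bounded
      (ENNReal.summable_toReal M.tsum_lengthsLaw_mul_prefixBound_ne_top) fun p => ?_
    have h0 := ENNReal.ne_top_of_tsum_ne_top M.tsum_lengthsLaw_mul_prefixBound_ne_top p
    rw [← toReal_enorm]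
    refine ENNReal.toReal_mono h0 ?_
    rw [enorm_mul, Real.enorm_of_nonneg ENNReal.toReal_nonneg,
      ENNReal.ofReal_toReal (measure_ne_top _ _)]
    gcongr
    exact M.enorm_prefixReturn_le π p
  simp only [hint]
  rw [value_eq_tsum_prefix, ← (Equiv.prodComm ℕ (List ℕ+)).tsum_eq]
  exact ((Equiv.prodComm ℕ (List ℕ+)).summable_iff.2 hs).tsum_prod

end DRMDP

/-! ### Policies in `Π_{τ,c}` from given action laws. -/

section TauPolicy

variable {S : Type u} {A : Type v} [MeasurableSpace S] [MeasurableSpace A] {c : ℕ}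

@[fun_prop]
theorem measurable_historySegment (c t a : ℕ) :
    Measurable fun τ : Fin t → S × A => historySegment c τ a :=
  measurable_subsegment c t a (t - a)

/-- The policy in `Π_{τ,c}` with the given action laws. -/
noncomputable def tauPolicy (σ : (k : ℕ) → Kernel ((Fin (c + k) → Token S A) × S) A)
    (hσ : ∀ k, IsMarkovKernel (σ k)) : Policy S A where
  act t L := (σ (t - duration L)).comap
    (fun x => (historySegment c x.1 (duration L), x.2)) (by fun_prop)
  isMarkovKernel_act t L := by have := hσ; infer_instance

theorem isTau_tauPolicy (σ : (k : ℕ) → Kernel ((Fin (c + k) → Token S A) × S) A)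
    (hσ : ∀ k, IsMarkovKernel (σ k)) : (tauPolicy σ hσ).IsTau c :=
  ⟨σ, fun _ _ _ _ _ => rfl⟩

end TauPolicy

/-! ### Flows are determined by their action laws. -/

namespace DRMDP

variable {S : Type u} {A : Type v} [MeasurableSpace S] [MeasurableSpace A]
variable {c : ℕ} (M : DRMDP c S A) (π : Policy S A)

/-- Every `μ k` disintegrates along the action laws `σ k`. -/
def Disintegrates (μ : (k : ℕ) → Measure (((Fin (c + k) → Token S A) × S) × A))
    (σ : (k : ℕ) → Kernel ((Fin (c + k) → Token S A) × S) A) : Prop :=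
  ∀ (k : ℕ) (f : ((Fin (c + k) → Token S A) × S) × A → ℝ≥0∞), Measurable f →
    ∫⁻ y, f y ∂μ k = ∫⁻ y, ∫⁻ a, f (y.1, a) ∂σ k y.1 ∂μ k

theorem disintegrates_occupation_tauPolicy
    (σ : (k : ℕ) → Kernel ((Fin (c + k) → Token S A) × S) A) (hσ : ∀ k, IsMarkovKernel (σ k)) :
    Disintegrates (M.occupation (tauPolicy σ hσ)) σ := fun k _ hf =>
  M.lintegral_occupation_of_isTau _ (fun _ _ _ _ _ => rfl) hσ k hf

variable {M}

/-- Integrals at position `k` of an interval are integrals at its beginning. -/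
theorem exists_lintegral_eq_lintegral_zero
    (σ : (k : ℕ) → Kernel ((Fin (c + k) → Token S A) × S) A) (hσ : ∀ k, IsMarkovKernel (σ k))
    (k : ℕ) {g : ((Fin (c + k) → Token S A) × S) × A → ℝ≥0∞} (hg : Measurable g)
    (hg1 : ∀ y, g y ≤ 1) :
    ∃ h : (Fin (c + 0) → Token S A) × S → ℝ≥0∞, Measurable h ∧ (∀ x, h x ≤ 1) ∧
      ∀ μ, M.IsFlow μ → Disintegrates μ σ → ∫⁻ y, g y ∂μ k = ∫⁻ y, h y.1 ∂μ 0 := by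
  have hm : Measurable fun x => ∫⁻ a, g (x, a) ∂σ k x :=
    Measurable.lintegral_kernel_prod_right' hg
  have h1 : ∀ x, ∫⁻ a, g (x, a) ∂σ k x ≤ 1 := fun x =>
    (lintegral_mono fun a => hg1 (x, a)).trans (by simp)
  induction k with
  | zero => exact ⟨_, hm, h1, fun μ _ hd => hd 0 g hg⟩
  | succ k ih =>
    have hs := M.measurable_stepForward hm
    have hs1 : ∀ y, M.stepForward (fun x => ∫⁻ a, g (x, a) ∂σ (k + 1) x) y ≤ 1 := fun y =>
      (lintegral_mono fun s => h1 _).trans (by simp)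
    -- Integrating out the action and then one transition lowers the offset by 1. The resulting `h`
    -- depends on `M` and `σ` but not on the flow, so it can serve two flows at once.
    obtain ⟨h, hh, hh1, H⟩ := ih hs hs1 (Measurable.lintegral_kernel_prod_right' hs)
      (fun x => (lintegral_mono fun a => hs1 (x, a)).trans (by simp))
    refine ⟨h, hh, hh1, fun μ hμ hd => ?_⟩
    rw [hd (k + 1) g hg, hμ.lintegral_succ k _ hm, H μ hμ hd]

/-- Both flows solve the same recursion from one interval start to the next, which contracts by `γ`.
A one-sided estimate with an error term avoids subtraction in `ℝ≥0∞`; equality follows by symmetry.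
-/
theorem lintegral_zero_le_of_isFlow
    {σ : (k : ℕ) → Kernel ((Fin (c + k) → Token S A) × S) A} (hσ : ∀ k, IsMarkovKernel (σ k))
    {μ μ' : (k : ℕ) → Measure (((Fin (c + k) → Token S A) × S) × A)}
    (hμ : M.IsFlow μ) (hμ' : M.IsFlow μ') (hd : Disintegrates μ σ) (hd' : Disintegrates μ' σ)
    {f : (Fin (c + 0) → Token S A) × S → ℝ≥0∞} (hf : Measurable f) (hf1 : ∀ x, f x ≤ 1) :
    ∫⁻ y, f y.1 ∂μ 0 ≤ ∫⁻ y, f y.1 ∂μ' 0 := by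
  have := hμ.isFiniteMeasure 0
  -- After `N` interval ends the discrepancy is at most `γ ^ N` times the total mass. The function
  -- `f` varies in the induction, as each pass replaces it by the pulled-back `h`.
  have key : ∀ (N : ℕ) (f : (Fin (c + 0) → Token S A) × S → ℝ≥0∞), Measurable f →
      (∀ x, f x ≤ 1) →
      ∫⁻ y, f y.1 ∂μ 0 ≤ ∫⁻ y, f y.1 ∂μ' 0 + ENNReal.ofReal M.discount ^ N * μ 0 Set.univ := by
    intro N
    induction N with
    | zero =>
      intro f _ hf1
      rw [pow_zero, one_mul]
      refine le_add_left ?_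
      calc ∫⁻ y, f y.1 ∂μ 0 ≤ ∫⁻ _, 1 ∂μ 0 := lintegral_mono fun y => hf1 y.1
        _ = μ 0 Set.univ := lintegral_one
    | succ N ih =>
      intro f hf hf1
      rw [hμ.lintegral_zero f hf, hμ'.lintegral_zero f hf, add_assoc]
      gcongr
      calc ∑' k : ℕ, M.lengthWeight k.succPNat *
            ∫⁻ y, M.stepForward (fun x => f (overlap x.1, x.2)) y ∂μ k
          ≤ ∑' k : ℕ, (M.lengthWeight k.succPNat *
            ∫⁻ y, M.stepForward (fun x => f (overlap x.1, x.2)) y ∂μ' k +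
              M.lengthWeight k.succPNat * (ENNReal.ofReal M.discount ^ N * μ 0 Set.univ)) := by
            refine ENNReal.tsum_le_tsum fun k => ?_
            rw [← mul_add]
            gcongr
            have hs : Measurable (M.stepForward (k := k) fun x => f (overlap x.1, x.2)) :=
              M.measurable_stepForward (by fun_prop)
            obtain ⟨h, hh, hh1, H⟩ := exists_lintegral_eq_lintegral_zero (M := M) σ hσ k hs
              fun y => (lintegral_mono fun s => hf1 _).trans (by simp)
            rw [H μ hμ hd, H μ' hμ' hd']
            exact ih h hh hh1
        _ ≤ _ := by
            rw [ENNReal.tsum_add, ENNReal.tsum_mul_right,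
              ← tsum_pnat_eq_tsum_succPNat M.lengthWeight, pow_succ', mul_assoc]
            gcongr
            exact M.tsum_lengthWeight_le
  refine ge_of_tendsto' (f := fun N : ℕ => ∫⁻ y, f y.1 ∂μ' 0 +
    ENNReal.ofReal M.discount ^ N * μ 0 Set.univ) (x := Filter.atTop) ?_ fun N => key N f hf hf1
  have h0 : Filter.Tendsto (fun N : ℕ => ENNReal.ofReal M.discount ^ N * μ 0 Set.univ)
      Filter.atTop (nhds (0 * μ 0 Set.univ)) := by
    refine ENNReal.Tendsto.mul_const (ENNReal.tendsto_pow_atTop_nhds_zero_of_lt_one ?_)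
      (Or.inr (measure_ne_top _ _))
    rw [← ENNReal.ofReal_one]
    exact (ENNReal.ofReal_lt_ofReal_iff one_pos).2 M.discount_lt_one
  simpa using h0.const_add (∫⁻ y, f y.1 ∂μ' 0)

/-- Discounted occupation measures are determined by the action laws. -/
theorem IsFlow.eq_of_disintegrates
    {σ : (k : ℕ) → Kernel ((Fin (c + k) → Token S A) × S) A} (hσ : ∀ k, IsMarkovKernel (σ k))
    {μ μ' : (k : ℕ) → Measure (((Fin (c + k) → Token S A) × S) × A)}
    (hμ : M.IsFlow μ) (hμ' : M.IsFlow μ') (hd : Disintegrates μ σ) (hd' : Disintegrates μ' σ) :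
    μ = μ' := by
  ext k E hE
  have hg : Measurable (E.indicator fun _ => (1 : ℝ≥0∞)) := measurable_const.indicator hE
  obtain ⟨h, hh, hh1, H⟩ := exists_lintegral_eq_lintegral_zero (M := M) σ hσ k hg
    fun y => Set.indicator_le_self' (fun _ _ => zero_le_one) y
  rw [← lintegral_indicator_one hE, ← lintegral_indicator_one hE]
  change ∫⁻ y, E.indicator (fun _ => (1 : ℝ≥0∞)) y ∂μ k =
    ∫⁻ y, E.indicator (fun _ => (1 : ℝ≥0∞)) y ∂μ' k
  rw [H μ hμ hd, H μ' hμ' hd']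
  exact le_antisymm (lintegral_zero_le_of_isFlow hσ hμ hμ' hd hd' hh hh1)
    (lintegral_zero_le_of_isFlow hσ hμ' hμ hd' hd hh hh1)

variable (M)

/-- Every policy has the same value as some policy in `Π_{τ,c}`. -/
theorem exists_isTau_value_eq [StandardBorelSpace A] :
    ∃ π' : Policy S A, π'.IsTau c ∧ M.value π' = M.value π := by
  have : Nonempty A := by
    obtain ⟨s⟩ : Nonempty S := nonempty_of_isProbabilityMeasure M.init
    exact nonempty_of_isProbabilityMeasure (π.act 0 [] (fun j : Fin 0 => j.elim0, s))
  -- Conditioning the summed measure averages the actions of `π` over the interval number, the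
  -- completed lengths and the forgotten past.
  let σ : (k : ℕ) → Kernel ((Fin (c + k) → Token S A) × S) A := fun k =>
    (M.occupation π k).condKernel
  have hσ : ∀ k, IsMarkovKernel (σ k) := fun k => inferInstance
  have hd : Disintegrates (M.occupation π) σ := fun k f hf => by
    rw [← Measure.lintegral_condKernel hf, Measure.fst,
      lintegral_map (Measurable.lintegral_kernel_prod_right' hf) measurable_fst]
  refine ⟨tauPolicy σ hσ, isTau_tauPolicy σ hσ, ?_⟩
  rw [value_eq_tsum_occupation, value_eq_tsum_occupation,
    (M.isFlow_occupation (tauPolicy σ hσ)).eq_of_disintegrates hσ (M.isFlow_occupation π)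
      (M.disintegrates_occupation_tauPolicy σ hσ) hd]

end DRMDP

/-! ### Verification: optimality equations integrated against a flow. -/

namespace DRMDP

variable {S : Type u} {A : Type v} [MeasurableSpace S] [MeasurableSpace A]
variable {c : ℕ} (M : DRMDP c S A) (π : Policy S A)

/-- The expectation of a function of the extended segment and the next state. -/
noncomputable def stepIntegral {k : ℕ} (f : (Fin (c + (k + 1)) → Token S A) × S → ℝ)
    (y : ((Fin (c + k) → Token S A) × S) × A) : ℝ :=
  ∫ s, f (appendStep y.1.1 y.1.2 y.2, s) ∂M.trans (y.1.2, y.2)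

theorem measurable_appendStep_prod (k : ℕ) :
    Measurable fun z : (((Fin (c + k) → Token S A) × S) × A) × S =>
      ((appendStep z.1.1.1 z.1.1.2 z.1.2, z.2) : (Fin (c + (k + 1)) → Token S A) × S) :=
  (Measurable.appendStep (m := c + k) (by fun_prop) (by fun_prop) (by fun_prop)).prodMk
    measurable_snd

theorem measurable_stepIntegral {k : ℕ} {f : (Fin (c + (k + 1)) → Token S A) × S → ℝ}
    (hf : Measurable f) : Measurable (M.stepIntegral f) :=
  (StronglyMeasurable.integral_kernel_prod_right'
    (κ := M.trans.comap (fun y : ((Fin (c + k) → Token S A) × S) × A => (y.1.2, y.2))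
      (by fun_prop)) (hf.comp (measurable_appendStep_prod k)).stronglyMeasurable).measurable

theorem abs_stepIntegral_le {k : ℕ} {f : (Fin (c + (k + 1)) → Token S A) × S → ℝ} {C : ℝ}
    (hC : ∀ x, |f x| ≤ C) (y : ((Fin (c + k) → Token S A) × S) × A) :
    |M.stepIntegral f y| ≤ C := by
  have h := norm_integral_le_of_norm_le_const (μ := M.trans (y.1.2, y.2))
    (f := fun s => f (appendStep y.1.1 y.1.2 y.2, s)) (ae_of_all _ fun s => hC _)
  simpa [stepIntegral] using h

/-- The law of the extended segment and the next state. -/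
noncomputable def stepLaw {k : ℕ} (μ : Measure (((Fin (c + k) → Token S A) × S) × A)) :
    Measure ((Fin (c + (k + 1)) → Token S A) × S) :=
  (μ ⊗ₘ M.trans.comap (fun y : ((Fin (c + k) → Token S A) × S) × A => (y.1.2, y.2))
    (by fun_prop)).map fun z => (appendStep z.1.1.1 z.1.1.2 z.1.2, z.2)

instance {k : ℕ} (μ : Measure (((Fin (c + k) → Token S A) × S) × A)) [IsFiniteMeasure μ] :
    IsFiniteMeasure (M.stepLaw μ) := by
  unfold stepLaw; infer_instance

theorem lintegral_stepLaw {k : ℕ} (μ : Measure (((Fin (c + k) → Token S A) × S) × A))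
    [IsFiniteMeasure μ] {f : (Fin (c + (k + 1)) → Token S A) × S → ℝ≥0∞} (hf : Measurable f) :
    ∫⁻ x, f x ∂M.stepLaw μ = ∫⁻ y, M.stepForward f y ∂μ := by
  rw [stepLaw, lintegral_map hf (measurable_appendStep_prod k)]
  exact Measure.lintegral_compProd (hf.comp (measurable_appendStep_prod k))

theorem integral_stepLaw {k : ℕ} (μ : Measure (((Fin (c + k) → Token S A) × S) × A))
    [IsFiniteMeasure μ] {f : (Fin (c + (k + 1)) → Token S A) × S → ℝ} (hf : Measurable f)
    {C : ℝ} (hC : ∀ x, |f x| ≤ C) :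
    ∫ x, f x ∂M.stepLaw μ = ∫ y, M.stepIntegral f y ∂μ := by
  rw [stepLaw, integral_map (measurable_appendStep_prod k).aemeasurable hf.aestronglyMeasurable,
    Measure.integral_compProd]
  · rfl
  · exact Integrable.of_bound (hf.comp (measurable_appendStep_prod k)).aestronglyMeasurable C
      (ae_of_all _ fun z => hC _)

variable {M}

/-- The flow equation for nonnegative functions identifies two measures, and so extends to bounded
real functions. -/
theorem IsFlow.integral_succ {μ : (k : ℕ) → Measure (((Fin (c + k) → Token S A) × S) × A)}
    (hμ : M.IsFlow μ) (k : ℕ) {f : (Fin (c + (k + 1)) → Token S A) × S → ℝ} (hf : Measurable f)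
    {C : ℝ} (hC : ∀ x, |f x| ≤ C) :
    ∫ y, f y.1 ∂μ (k + 1) = ∫ y, M.stepIntegral f y ∂μ k := by
  have := hμ.isFiniteMeasure k
  have h : (μ (k + 1)).map Prod.fst = M.stepLaw (μ k) := by
    refine Measure.ext_of_lintegral _ fun g hg => ?_
    rw [lintegral_map hg measurable_fst, M.lintegral_stepLaw _ hg, hμ.lintegral_succ k g hg]
  rw [← M.integral_stepLaw _ hf hC, ← h,
    integral_map measurable_fst.aemeasurable hf.aestronglyMeasurable]

theorem IsFlow.hasSum_integral_zero
    {μ : (k : ℕ) → Measure (((Fin (c + k) → Token S A) × S) × A)}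
    (hμ : M.IsFlow μ) {f : (Fin (c + 0) → Token S A) × S → ℝ} (hf : Measurable f)
    {C : ℝ} (hC : ∀ x, |f x| ≤ C) :
    HasSum (fun k : ℕ => (M.lengthWeight k.succPNat).toReal *
        ∫ y, M.stepIntegral (fun x => f (overlap x.1, x.2)) y ∂μ k)
      (∫ y, f y.1 ∂μ 0 - ∫ s, f (fun _ => Sum.inl (), s) ∂M.init) := by
  have := hμ.isFiniteMeasure
  have ho : ∀ k : ℕ, Measurable fun x : (Fin (c + (k + 1)) → Token S A) × S =>
      (overlap x.1, x.2) := fun k => by fun_prop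
  have hi : Measurable fun s : S => ((fun _ => Sum.inl () : Fin (c + 0) → Token S A), s) := by
    fun_prop
  set ν : ℕ → Measure ((Fin (c + 0) → Token S A) × S) := fun k =>
    M.lengthWeight k.succPNat • (M.stepLaw (μ k)).map fun x => (overlap x.1, x.2) with hν
  set ι : Measure ((Fin (c + 0) → Token S A) × S) :=
    M.init.map fun s => (fun _ => Sum.inl (), s) with hι
  have h : (μ 0).map Prod.fst = ι + Measure.sum ν := by
    refine Measure.ext_of_lintegral _ fun g hg => ?_
    rw [lintegral_map hg measurable_fst, hμ.lintegral_zero g hg, lintegral_add_measure,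
      lintegral_map hg hi, lintegral_sum_measure]
    congr 1
    refine tsum_congr fun k => ?_
    rw [lintegral_smul_measure, lintegral_map hg (ho k),
      M.lintegral_stepLaw (μ k) (f := fun x => g (overlap x.1, x.2)) (hg.comp (ho k)),
      smul_eq_mul]
  have hint : Integrable f (ι + Measure.sum ν) := by
    rw [← h]
    exact Integrable.of_bound hf.aestronglyMeasurable C (ae_of_all _ hC)
  rw [integrable_add_measure] at hint
  have hsum := hasSum_integral_measure hint.2
  have e1 : ∫ x, f x ∂Measure.sum ν =
      ∫ y, f y.1 ∂μ 0 - ∫ s, f (fun _ => Sum.inl (), s) ∂M.init := by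
    rw [eq_sub_iff_add_eq', ← integral_map hi.aemeasurable hf.aestronglyMeasurable, ← hι,
      ← integral_add_measure hint.1 hint.2, ← h,
      integral_map measurable_fst.aemeasurable hf.aestronglyMeasurable]
  have e2 : (fun k : ℕ => (M.lengthWeight k.succPNat).toReal *
      ∫ y, M.stepIntegral (fun x => f (overlap x.1, x.2)) y ∂μ k) =
        fun k => ∫ x, f x ∂ν k := by
    funext k
    rw [hν]
    beta_reduce
    rw [integral_smul_measure, integral_map (ho k).aemeasurable hf.aestronglyMeasurable,
      M.integral_stepLaw (μ k) (f := fun x => f (overlap x.1, x.2)) (hf.comp (ho k))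
        fun x => hC _, smul_eq_mul]
  rw [← e1, e2]
  exact hsum

/-- Intervals are continued forever, so no mass is lost with growing offset; bounds that are uniform
in the point thus control integrals uniformly in `k`. -/
theorem IsFlow.measure_univ {μ : (k : ℕ) → Measure (((Fin (c + k) → Token S A) × S) × A)}
    (hμ : M.IsFlow μ) (k : ℕ) : μ k Set.univ = μ 0 Set.univ := by
  induction k with
  | zero => rfl
  | succ k ih =>
    rw [← ih]
    simpa [stepForward] using hμ.lintegral_succ k (fun _ => 1) measurable_const

variable (M)

/-- The expected weighted reward of an action plus the value `U` of the continuation. -/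
noncomputable def actionValue (U : (k : ℕ) → (Fin (c + k) → Token S A) × S → ℝ) (k : ℕ)
    (y : ((Fin (c + k) → Token S A) × S) × A) : ℝ :=
  M.weightedReward k y +
    (M.lengthWeight k.succPNat).toReal * M.stepIntegral (fun x => U 0 (overlap x.1, x.2)) y +
    M.stepIntegral (U (k + 1)) y

theorem measurable_actionValue {U : (k : ℕ) → (Fin (c + k) → Token S A) × S → ℝ}
    (hU : ∀ k, Measurable (U k)) (k : ℕ) : Measurable (M.actionValue U k) := by
  have h1 : Measurable (M.stepIntegral (k := k) fun x => U 0 (overlap x.1, x.2)) :=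
    M.measurable_stepIntegral ((hU 0).comp (by fun_prop))
  have h2 := M.measurable_stepIntegral (hU (k + 1))
  unfold actionValue
  fun_prop

variable {M}

theorem IsFlow.integral_actionValue
    {μ : (k : ℕ) → Measure (((Fin (c + k) → Token S A) × S) × A)} (hμ : M.IsFlow μ)
    {U : (k : ℕ) → (Fin (c + k) → Token S A) × S → ℝ} (hU : ∀ k, Measurable (U k))
    {T : ℕ → ℝ} (hT : ∀ k x, |U k x| ≤ T k) (k : ℕ) :
    Integrable (M.actionValue U k) (μ k) ∧
    ∫ y, M.actionValue U k y ∂μ k = ∫ y, M.weightedReward k y ∂μ k +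
      (M.lengthWeight k.succPNat).toReal *
        ∫ y, M.stepIntegral (fun x => U 0 (overlap x.1, x.2)) y ∂μ k +
      ∫ y, U (k + 1) y.1 ∂μ (k + 1) := by
  have := hμ.isFiniteMeasure k
  have h0 := M.integrable_weightedReward k (μ k)
  have h1 : Integrable (M.stepIntegral (k := k) fun x => U 0 (overlap x.1, x.2)) (μ k) :=
    Integrable.of_bound
      (M.measurable_stepIntegral ((hU 0).comp (by fun_prop))).aestronglyMeasurable (T 0)
      (ae_of_all _ (M.abs_stepIntegral_le fun x => hT 0 _))
  have h2 : Integrable (M.stepIntegral (U (k + 1))) (μ k) :=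
    Integrable.of_bound (M.measurable_stepIntegral (hU (k + 1))).aestronglyMeasurable (T (k + 1))
      (ae_of_all _ (M.abs_stepIntegral_le (hT (k + 1))))
  have h01 : Integrable (fun y => M.weightedReward k y + (M.lengthWeight k.succPNat).toReal *
      M.stepIntegral (fun x => U 0 (overlap x.1, x.2)) y) (μ k) := h0.add (h1.const_mul _)
  refine ⟨h01.add h2, ?_⟩
  unfold actionValue
  rw [integral_add h01 h2, integral_add h0 (h1.const_mul _), integral_const_mul,
    hμ.integral_succ k (hU (k + 1)) (hT (k + 1))]

/-- The verification theorem: a solution of the optimality inequalities bounds the return from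
above, and a solution of the optimality equations attains it. -/
theorem IsFlow.tsum_weightedReward
    {μ : (k : ℕ) → Measure (((Fin (c + k) → Token S A) × S) × A)} (hμ : M.IsFlow μ)
    {U : (k : ℕ) → (Fin (c + k) → Token S A) × S → ℝ} (hU : ∀ k, Measurable (U k))
    {T : ℕ → ℝ} (hT : ∀ k x, |U k x| ≤ T k) (hT0 : Filter.Tendsto T Filter.atTop (nhds 0)) :
    ((∀ k y, M.actionValue U k y ≤ U k y.1) →
      ∑' k, ∫ y, M.weightedReward k y ∂μ k ≤ ∫ s, U 0 (fun _ => Sum.inl (), s) ∂M.init) ∧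
    ((∀ k, ∀ᵐ y ∂μ k, M.actionValue U k y = U k y.1) →
      ∑' k, ∫ y, M.weightedReward k y ∂μ k = ∫ s, U 0 (fun _ => Sum.inl (), s) ∂M.init) := by
  have := hμ.isFiniteMeasure
  set a : ℕ → ℝ := fun k => ∫ y, M.weightedReward k y ∂μ k with ha
  set e : ℕ → ℝ := fun k => (M.lengthWeight k.succPNat).toReal *
        ∫ y, M.stepIntegral (fun x => U 0 (overlap x.1, x.2)) y ∂μ k with he
  set w : ℕ → ℝ := fun k => ∫ y, U k y.1 ∂μ k with hw
  have hmass : ∀ k, (μ k).real Set.univ = (μ 0).real Set.univ := fun k => by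
    rw [measureReal_def, hμ.measure_univ k, measureReal_def]
  -- By the flow equation at offset 0, the continuation values after the interval ends add up to `w
  -- 0` without the initial contribution.
  have hse : HasSum e (w 0 - ∫ s, U 0 (fun _ => Sum.inl (), s) ∂M.init) :=
    hμ.hasSum_integral_zero (hU 0) (hT 0)
  have hsa : Summable a := by
    obtain ⟨β, hβ, hβ'⟩ := M.exists_summable_abs_weightedReward_le
    refine Summable.of_norm_bounded (hβ.mul_right ((μ 0).real Set.univ)) fun k => ?_
    rw [← hmass k]
    exact norm_integral_le_of_norm_le_const (ae_of_all _ (hβ' k))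
  have hw0 : Filter.Tendsto w Filter.atTop (nhds 0) := by
    refine squeeze_zero_norm (a := fun k => T k * (μ 0).real Set.univ) (fun k => ?_)
      (by simpa using hT0.mul_const ((μ 0).real Set.univ))
    rw [← hmass k]
    exact norm_integral_le_of_norm_le_const (ae_of_all _ fun y => hT k y.1)
  -- The boundary term at infinity vanishes because `T` tends to 0. Comparing this sum with that of
  -- `a k + e k` cancels `w 0` and leaves the initial value.
  have htel : Filter.Tendsto (fun N => ∑ k ∈ Finset.range N, (w k - w (k + 1))) Filter.atTop
      (nhds (w 0)) := by
    simp only [Finset.sum_range_sub']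
    simpa using hw0.const_sub (w 0)
  have hsum : Filter.Tendsto (fun N => ∑ k ∈ Finset.range N, (a k + e k)) Filter.atTop
      (nhds (∑' k, a k + (w 0 - ∫ s, U 0 (fun _ => Sum.inl (), s) ∂M.init))) :=
    (hsa.hasSum.add hse).tendsto_sum_nat
  have hUi : ∀ k, Integrable (fun y => U k y.1) (μ k) := fun k =>
    Integrable.of_bound ((hU k).comp measurable_fst).aestronglyMeasurable (T k)
      (ae_of_all _ fun y => hT k y.1)
  constructor
  · intro h
    have hle : ∀ k, a k + e k ≤ w k - w (k + 1) := fun k => by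
      have h1 := hμ.integral_actionValue hU hT k
      have h2 := integral_mono h1.1 (hUi k) (h k)
      rw [h1.2] at h2
      linarith
    have := le_of_tendsto_of_tendsto' hsum htel fun N => Finset.sum_le_sum fun k _ => hle k
    linarith
  · intro h
    have heq : ∀ k, a k + e k = w k - w (k + 1) := fun k => by
      have h1 := hμ.integral_actionValue hU hT k
      have h2 := integral_congr_ae (h k)
      rw [h1.2] at h2
      linarith
    simp only [heq] at hsum
    have := tendsto_nhds_unique hsum htel
    linarith

end DRMDP

/-! ### Solving the optimality equations for finitely many actions. -/

theorem exists_measurable_forall_of_finite {X : Type*} {A : Type*} [MeasurableSpace X]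
    [MeasurableSpace A] [Finite A] [Nonempty A] {p : A → X → Prop}
    (hp : ∀ a, MeasurableSet {x | p a x}) (h : ∀ x, ∃ a, p a x) :
    ∃ φ : X → A, Measurable φ ∧ ∀ x, p (φ x) x := by
  classical
  obtain ⟨e, he⟩ := exists_surjective_nat A
  have h' : ∀ x, ∃ n, p (e n) x := fun x => by
    obtain ⟨a, ha⟩ := h x
    obtain ⟨n, rfl⟩ := he a
    exact ⟨n, ha⟩
  -- The first admissible action in a fixed enumeration is a measurable choice.
  exact ⟨fun x => e (Nat.find (h' x)),
    Measurable.find (f := fun n _ => e n) (p := fun n x => p (e n) x)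
      (fun n => measurable_const) (fun n => hp _) h', fun x => Nat.find_spec (h' x)⟩

namespace DRMDP

variable {S : Type u} {A : Type v} [MeasurableSpace S] [MeasurableSpace A]
variable {c : ℕ} (M : DRMDP c S A)

theorem tsum_toReal_lengthWeight_le :
    (Summable fun k : ℕ => (M.lengthWeight k.succPNat).toReal) ∧
      ∑' k : ℕ, (M.lengthWeight k.succPNat).toReal ≤ M.discount := by
  have h : ∑' k : ℕ, M.lengthWeight k.succPNat ≤ ENNReal.ofReal M.discount := by
    rw [← tsum_pnat_eq_tsum_succPNat]; exact M.tsum_lengthWeight_le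
  have h' := ne_top_of_le_ne_top ENNReal.ofReal_ne_top h
  refine ⟨ENNReal.summable_toReal h', ?_⟩
  rw [← ENNReal.tsum_toReal_eq fun k => ENNReal.ne_top_of_tsum_ne_top h' k]
  exact ENNReal.toReal_le_of_le_ofReal M.discount_nonneg h

/-- A constant supersolution of the optimality equations. -/
theorem exists_supersolution : ∃ β T : ℕ → ℝ, (∀ k y, |M.weightedReward k y| ≤ β k) ∧
    (∀ k, β k + (M.lengthWeight k.succPNat).toReal * T 0 + T (k + 1) ≤ T k) ∧
    (∀ k, 0 ≤ T k) ∧ Filter.Tendsto T Filter.atTop (nhds 0) := by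
  obtain ⟨β, hβ, hβ'⟩ := M.exists_summable_abs_weightedReward_le
  obtain ⟨hδ, hδ'⟩ := M.tsum_toReal_lengthWeight_le
  set δ : ℕ → ℝ := fun k => (M.lengthWeight k.succPNat).toReal with hδe
  set β' : ℕ → ℝ := fun k => |β k| with hβe
  have hs : Summable β' := hβ.abs
  have h0 : 0 ≤ ∑' k, β' k := tsum_nonneg fun k => abs_nonneg _
  have hγ : 0 < 1 - M.discount := sub_pos.2 M.discount_lt_one
  -- `C` solves `∑ β' + γ C = C`: it bounds the total reward when each interval end is worth `C`
  -- again.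
  set C : ℝ := (∑' k, β' k) / (1 - M.discount) with hC
  have hC0 : 0 ≤ C := div_nonneg h0 hγ.le
  have hCe : ∑' k, β' k + M.discount * C = C := by rw [hC]; field_simp; ring
  have hsum : Summable fun k => β' k + δ k * C := hs.add (hδ.mul_right C)
  -- Taking tails of the series for `C` makes `T` tend to 0, and `T 0 ≤ C` still gives the required
  -- inequality.
  refine ⟨β', fun k => ∑' j, (β' (j + k) + δ (j + k) * C), fun k y => (hβ' k y).trans (le_abs_self _),
    fun k => ?_, fun k => tsum_nonneg fun j => ?_, tendsto_sum_nat_add fun k => β' k + δ k * C⟩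
  swap
  · have : 0 ≤ δ (j + k) := ENNReal.toReal_nonneg
    have : 0 ≤ β' (j + k) := abs_nonneg _
    positivity
  have hT0 : ∑' j, (β' (j + 0) + δ (j + 0) * C) ≤ C := by
    simp only [add_zero]
    rw [hs.tsum_add (hδ.mul_right C), tsum_mul_right]
    calc _ ≤ ∑' k, β' k + M.discount * C := by gcongr
      _ = C := hCe
  have hk : ∑' j, (β' (j + k) + δ (j + k) * C) =
      β' k + δ k * C + ∑' j, (β' (j + (k + 1)) + δ (j + (k + 1)) * C) := by
    rw [((summable_nat_add_iff k).2 hsum).tsum_eq_zero_add]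
    simp only [zero_add]
    congr 1
    exact tsum_congr fun j => by rw [add_right_comm, add_assoc]
  beta_reduce
  rw [hk]
  have hδ0 : 0 ≤ δ k := ENNReal.toReal_nonneg
  have := mul_le_mul_of_nonneg_left hT0 hδ0
  linarith

variable {M}

theorem stepIntegral_mono {k : ℕ} {f g : (Fin (c + (k + 1)) → Token S A) × S → ℝ}
    (hf : Measurable f) (hg : Measurable g) {C : ℝ} (hfC : ∀ x, |f x| ≤ C) (hgC : ∀ x, |g x| ≤ C)
    (h : ∀ x, f x ≤ g x) (y : ((Fin (c + k) → Token S A) × S) × A) :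
    M.stepIntegral f y ≤ M.stepIntegral g y := by
  have hm : Measurable fun s : S =>
      ((appendStep y.1.1 y.1.2 y.2, s) : (Fin (c + (k + 1)) → Token S A) × S) :=
    measurable_const.prodMk measurable_id
  exact integral_mono
    (Integrable.of_bound (hf.comp hm).aestronglyMeasurable C (ae_of_all _ fun s => hfC _))
    (Integrable.of_bound (hg.comp hm).aestronglyMeasurable C (ae_of_all _ fun s => hgC _))
    fun s => h _

theorem tendsto_stepIntegral {k : ℕ} {f : ℕ → (Fin (c + (k + 1)) → Token S A) × S → ℝ}
    {g : (Fin (c + (k + 1)) → Token S A) × S → ℝ}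
    (hf : ∀ m, Measurable (f m)) {C : ℝ} (hfC : ∀ m x, |f m x| ≤ C)
    (h : ∀ x, Filter.Tendsto (fun m => f m x) Filter.atTop (nhds (g x)))
    (y : ((Fin (c + k) → Token S A) × S) × A) :
    Filter.Tendsto (fun m => M.stepIntegral (f m) y) Filter.atTop
      (nhds (M.stepIntegral g y)) := by
  have hm : Measurable fun s : S =>
      ((appendStep y.1.1 y.1.2 y.2, s) : (Fin (c + (k + 1)) → Token S A) × S) :=
    measurable_const.prodMk measurable_id
  exact tendsto_integral_of_dominated_convergence (fun _ => C)
    (fun m => ((hf m).comp hm).aestronglyMeasurable) (integrable_const C)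
    (fun m => ae_of_all _ fun s => hfC m _) (ae_of_all _ fun s => h _)

/-- The optimality equations have a solution that is dominated by the supersolution. -/
theorem exists_optimality_equation [Finite A] [Nonempty A] {β T : ℕ → ℝ}
    (hβ : ∀ k y, |M.weightedReward k y| ≤ β k)
    (hT : ∀ k, β k + (M.lengthWeight k.succPNat).toReal * T 0 + T (k + 1) ≤ T k)
    (hT0 : ∀ k, 0 ≤ T k) :
    ∃ U : (k : ℕ) → (Fin (c + k) → Token S A) × S → ℝ, (∀ k, Measurable (U k)) ∧
      (∀ k x, |U k x| ≤ T k) ∧ (∀ k y, M.actionValue U k y ≤ U k y.1) ∧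
      ∀ k x, ∃ a, M.actionValue U k (x, a) = U k x := by
  classical
  cases nonempty_fintype A
  have hδ0 : ∀ k : ℕ, 0 ≤ (M.lengthWeight k.succPNat).toReal := fun k => ENNReal.toReal_nonneg
  -- The Bellman operator. It is monotone and preserves the bound by `T`, so its iterates from `T`
  -- decrease.
  let B : ((k : ℕ) → (Fin (c + k) → Token S A) × S → ℝ) →
      (k : ℕ) → (Fin (c + k) → Token S A) × S → ℝ := fun U k x =>
    Finset.univ.sup' Finset.univ_nonempty fun a => M.actionValue U k (x, a)
  have hB : ∀ U k y, M.actionValue U k y ≤ B U k y.1 := fun U k y =>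
    Finset.le_sup' (fun a => M.actionValue U k (y.1, a)) (Finset.mem_univ y.2)
  have hBmeas : ∀ U, (∀ k, Measurable (U k)) → ∀ k, Measurable (B U k) := fun U hU k => by
    have h := Finset.measurable_sup' (f := fun a x => M.actionValue U k (x, a))
      (Finset.univ_nonempty (α := A)) fun a _ =>
        (M.measurable_actionValue hU k).comp (measurable_id.prodMk measurable_const)
    refine (congrArg Measurable ?_).mp h
    funext x
    exact Finset.sup'_apply _ _ _
  have hQabs : ∀ U, (∀ k x, |U k x| ≤ T k) → ∀ k y, |M.actionValue U k y| ≤ T k := by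
    intro U hU k y
    have h1 := M.abs_stepIntegral_le (f := fun x : (Fin (c + (k + 1)) → Token S A) × S =>
      U 0 (overlap x.1, x.2)) (fun x => hU 0 _) y
    have h2 := M.abs_stepIntegral_le (hU (k + 1)) y
    refine le_trans ?_ (hT k)
    refine (abs_add_le _ _).trans (add_le_add ((abs_add_le _ _).trans
      (add_le_add (hβ k y) ?_)) h2)
    rw [abs_mul, abs_of_nonneg (hδ0 k)]
    exact mul_le_mul_of_nonneg_left h1 (hδ0 k)
  have hBabs : ∀ U, (∀ k x, |U k x| ≤ T k) → ∀ k x, |B U k x| ≤ T k := by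
    intro U hU k x
    obtain ⟨a, -, ha⟩ := Finset.exists_mem_eq_sup' Finset.univ_nonempty
      fun a => M.actionValue U k (x, a)
    change |Finset.univ.sup' _ _| ≤ _
    rw [ha]
    exact hQabs U hU k _
  have hQmono : ∀ U V, (∀ k, Measurable (U k)) → (∀ k, Measurable (V k)) →
      (∀ k x, |U k x| ≤ T k) → (∀ k x, |V k x| ≤ T k) → (∀ k x, U k x ≤ V k x) →
      ∀ k y, M.actionValue U k y ≤ M.actionValue V k y := by
    intro U V hU hV hU' hV' h k y
    have h1 := stepIntegral_mono (M := M) (k := k) (f := fun x => U 0 (overlap x.1, x.2))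
      (g := fun x => V 0 (overlap x.1, x.2)) ((hU 0).comp (by fun_prop))
      ((hV 0).comp (by fun_prop)) (fun x => hU' 0 _) (fun x => hV' 0 _) (fun x => h 0 _) y
    have h2 := stepIntegral_mono (M := M) (hU (k + 1)) (hV (k + 1)) (hU' (k + 1)) (hV' (k + 1))
      (h (k + 1)) y
    unfold actionValue
    gcongr
  let W : ℕ → (k : ℕ) → (Fin (c + k) → Token S A) × S → ℝ := fun m => B^[m] fun k _ => T k
  have hW1 : ∀ m, W (m + 1) = B (W m) := fun m => Function.iterate_succ_apply' B m _
  have hWmeas : ∀ m k, Measurable (W m k) := by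
    intro m
    induction m with
    | zero => exact fun k => measurable_const
    | succ m ih => rw [hW1]; exact hBmeas _ ih
  have hWabs : ∀ m k x, |W m k x| ≤ T k := by
    intro m
    induction m with
    | zero => exact fun k x => (abs_of_nonneg (hT0 k)).le
    | succ m ih => rw [hW1]; exact hBabs _ ih
  have hWanti : ∀ m k x, W (m + 1) k x ≤ W m k x := by
    intro m
    induction m with
    | zero =>
      intro k x
      exact (le_abs_self _).trans (hWabs 1 k x)
    | succ m ih =>
      intro k x
      rw [hW1, hW1 m]
      exact Finset.sup'_mono_fun fun a _ => by
        rw [← hW1]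
        exact hQmono _ _ (hWmeas _) (hWmeas _) (hWabs _) (hWabs _) ih k (x, a)
  have hbdd : ∀ k x, BddBelow (Set.range fun m => W m k x) := fun k x =>
    ⟨-T k, by rintro _ ⟨m, rfl⟩; exact (abs_le.1 (hWabs m k x)).1⟩
  let U : (k : ℕ) → (Fin (c + k) → Token S A) × S → ℝ := fun k x => ⨅ m, W m k x
  have hlim : ∀ k x, Filter.Tendsto (fun m => W m k x) Filter.atTop (nhds (U k x)) := fun k x =>
    tendsto_atTop_ciInf (antitone_nat_of_succ_le fun m => hWanti m k x) (hbdd k x)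
  have hQlim : ∀ k y, Filter.Tendsto (fun m => M.actionValue (W m) k y) Filter.atTop
      (nhds (M.actionValue U k y)) := by
    intro k y
    have h1 := tendsto_stepIntegral (M := M) (k := k)
      (f := fun m x => W m 0 (overlap x.1, x.2)) (g := fun x => U 0 (overlap x.1, x.2))
      (fun m => (hWmeas m 0).comp (by fun_prop)) (fun m x => hWabs m 0 _) (fun x => hlim 0 _) y
    have h2 := tendsto_stepIntegral (M := M) (fun m => hWmeas m (k + 1))
      (fun m => hWabs m (k + 1)) (hlim (k + 1)) y
    exact (tendsto_const_nhds.add (h1.const_mul _)).add h2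
  -- Action values converge by dominated convergence, and a maximum over finitely many actions
  -- commutes with the limit.
  have hfix : ∀ k x, B U k x = U k x := by
    intro k x
    have h1 : Filter.Tendsto (fun m => B (W m) k x) Filter.atTop (nhds (B U k x)) :=
      Filter.Tendsto.finset_sup'_nhds_apply Finset.univ_nonempty fun a _ => hQlim k (x, a)
    have h2 : Filter.Tendsto (fun m => B (W m) k x) Filter.atTop (nhds (U k x)) := by
      simpa only [hW1] using (Filter.tendsto_add_atTop_iff_nat 1).2 (hlim k x)
    exact tendsto_nhds_unique h1 h2
  refine ⟨U, fun k => measurable_of_tendsto_metrizable (fun m => hWmeas m k)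
    (tendsto_pi_nhds.2 (hlim k)), fun k x => ?_, fun k y => (hB U k y).trans (hfix k y.1).le,
    fun k x => ?_⟩
  · exact le_of_tendsto (hlim k x).abs (Filter.Eventually.of_forall fun m => hWabs m k x)
  · obtain ⟨a, -, ha⟩ := Finset.exists_mem_eq_sup' Finset.univ_nonempty
      fun a => M.actionValue U k (x, a)
    exact ⟨a, ha.symm.trans (hfix k x)⟩

variable (M)

/-- With finitely many actions, some policy in `Π_{τ,c}` is optimal. -/
theorem exists_isOptimal_isTau [Finite A] [Nonempty A] :
    ∃ π : Policy S A, M.IsOptimal π ∧ π.IsTau c := by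
  obtain ⟨β, T, hβ, hT, hT0, hTlim⟩ := M.exists_supersolution
  obtain ⟨U, hU, hUT, hle, hex⟩ := exists_optimality_equation hβ hT hT0
  have hsel : ∀ k, ∃ φ : (Fin (c + k) → Token S A) × S → A, Measurable φ ∧
      ∀ x, M.actionValue U k (x, φ x) = U k x := fun k =>
    exists_measurable_forall_of_finite
      (fun a => measurableSet_eq_fun
        ((M.measurable_actionValue hU k).comp (measurable_id.prodMk measurable_const)) (hU k))
      (hex k)
  choose φ hφ hφU using hsel
  let σ : (k : ℕ) → Kernel ((Fin (c + k) → Token S A) × S) A := fun k =>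
    Kernel.deterministic (φ k) (hφ k)
  have hσ : ∀ k, IsMarkovKernel (σ k) := fun k => inferInstance
  refine ⟨tauPolicy σ hσ, fun π' => ?_, isTau_tauPolicy σ hσ⟩
  -- Under this policy the action is almost surely `φ k`, which attains the maximum; elsewhere only
  -- an inequality is available.
  have hae : ∀ k, ∀ᵐ y ∂M.occupation (tauPolicy σ hσ) k, M.actionValue U k y = U k y.1 := by
    intro k
    have hm : MeasurableSet {y | M.actionValue U k y = U k y.1} :=
      measurableSet_eq_fun (M.measurable_actionValue hU k) ((hU k).comp measurable_fst)
    have h := M.disintegrates_occupation_tauPolicy σ hσ k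
      ({y | M.actionValue U k y = U k y.1}ᶜ.indicator 1) (measurable_one.indicator hm.compl)
    rw [lintegral_indicator_one hm.compl] at h
    refine h.trans ?_
    have h0 : ∀ x, ∫⁻ a, {y | M.actionValue U k y = U k y.1}ᶜ.indicator
        (1 : ((Fin (c + k) → Token S A) × S) × A → ℝ≥0∞) (x, a) ∂σ k x = 0 := by
      intro x
      refine (Kernel.lintegral_deterministic' (hφ k) (f := fun a =>
        {y | M.actionValue U k y = U k y.1}ᶜ.indicator
          (1 : ((Fin (c + k) → Token S A) × S) × A → ℝ≥0∞) (x, a))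
        ((measurable_one.indicator hm.compl).comp
          (measurable_const.prodMk measurable_id))).trans ?_
      simp [hφU]
    simp [h0]
  rw [value_eq_tsum_occupation, value_eq_tsum_occupation,
    ((M.isFlow_occupation (tauPolicy σ hσ)).tsum_weightedReward hU hUT hTlim).2 hae]
  exact ((M.isFlow_occupation π').tsum_weightedReward hU hUT hTlim).1 hle

end DRMDP

/-! ### The exclusive-or example. -/

section Xor

instance : DiscreteMeasurableSpace (Token XorState Bool) :=
  ⟨fun _ => measurableSet_sum_iff.2 ⟨.of_discrete, .of_discrete⟩⟩

variable {c : ℕ} {γ : ℝ} (h0 : 0 ≤ γ) (h1 : γ < 1)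

theorem lastReward_xorDRMDP (y : ((Fin (c + 1) → Token XorState Bool) × XorState) × Bool) :
    (xorDRMDP c γ h0 h1).lastReward 1 y =
      xorPairReward (y.1.1 (Fin.last c)) (Sum.inr (y.1.2, y.2)) := by
  change xorReward c (Nat.succPNat 1) _ = _
  refine (dif_pos (show ((Nat.succPNat 1 : ℕ+) : ℕ) = 2 from rfl)).trans ?_
  congr 1
  · exact Fin.snoc_castSucc (α := fun _ => Token XorState Bool) (i := Fin.last c) ..
  · exact Fin.snoc_last (α := fun _ => Token XorState Bool) ..

theorem xorPairReward_eq_zero (s : XorState) (hs : ∀ i, s ≠ .start i) (a : Bool)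
    (x : Token XorState Bool) : xorPairReward (Sum.inr (s, a)) x = 0 := by
  cases s with
  | start i => exact absurd rfl (hs i)
  | mid => rfl
  | terminal => rfl

/-- The value of a policy that chooses `!i` with probability `q i` at `B` after `A_i`. -/
theorem value_xorDRMDP (π : Policy XorState Bool)
    (σ : (k : ℕ) → Kernel ((Fin (c + k) → Token XorState Bool) × XorState) Bool)
    (hσ : ∀ k, IsMarkovKernel (σ k))
    (hd : DRMDP.Disintegrates ((xorDRMDP c γ h0 h1).occupation π) σ)
    (q : Bool → ℝ≥0∞)
    (hq : ∀ (x : Fin (c + 0) → Token XorState Bool) i a,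
      σ 1 (appendStep x (.start i) a, .mid) {!i} = q i) :
    (xorDRMDP c γ h0 h1).value π = γ * (2⁻¹ * (q false + q true)).toReal := by
  set M := xorDRMDP c γ h0 h1 with hM
  have hfl := M.isFlow_occupation π
  -- All intervals have length 2, so rewards arise only at offset 1.
  have hk : ∀ k ≠ 1, ∫ y, M.weightedReward k y ∂M.occupation π k = 0 := by
    intro k hk
    have h : M.lengthLaw k.succPNat = 0 := by
      have : k.succPNat ≠ 2 := fun h => hk (Nat.succPNat_injective h)
      change PMF.pure 2 k.succPNat = 0
      rw [PMF.pure_apply, if_neg this]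
    simp [DRMDP.weightedReward, h]
  have hw : ∀ y, M.weightedReward 1 y = γ * M.lastReward 1 y := by
    intro y
    have h : M.lengthLaw (Nat.succPNat 1) = 1 := by
      change PMF.pure 2 (Nat.succPNat 1) = 1
      rw [PMF.pure_apply, if_pos (show Nat.succPNat 1 = 2 from rfl)]
    have hγ : M.discount = γ := rfl
    simp [DRMDP.weightedReward, h, hγ]
  have hnn : ∀ y, 0 ≤ M.lastReward 1 y := by
    intro y
    rw [hM, lastReward_xorDRMDP]
    unfold xorPairReward
    split
    · split <;> simp
    · exact le_rfl
  -- The expected reward of an interval that begins in state `s`.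
  let g : XorState → ℝ≥0∞ := fun s => match s with
    | .start i => q i
    | _ => 0
  have hg : Measurable g := .of_discrete
  have hR : Measurable fun y => ENNReal.ofReal (M.lastReward 1 y) :=
    (M.measurable_lastReward 1).ennreal_ofReal
  have hstep : ∀ y : ((Fin (c + 0) → Token XorState Bool) × XorState) × Bool,
      M.stepForward (fun x => ∫⁻ a, ENNReal.ofReal (M.lastReward 1 (x, a)) ∂σ 1 x) y =
        g y.1.2 := by
    rintro ⟨⟨x, s⟩, a⟩
    refine (Kernel.lintegral_deterministic'
      (Measurable.of_discrete : Measurable fun x : XorState × Bool => x.1.next) .of_discrete).trans ?_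
    simp only [hM, lastReward_xorDRMDP]
    have hl : (appendStep x s a : Fin (c + 0 + 1) → Token XorState Bool) (Fin.last c) =
        Sum.inr (s, a) := Fin.snoc_last (α := fun _ => Token XorState Bool) ..
    change ∫⁻ b, ENNReal.ofReal (xorPairReward ((appendStep x s a : Fin (c + 0 + 1) → _)
      (Fin.last c)) (Sum.inr (s.next, b))) ∂σ 1 (appendStep x s a, s.next) = g s
    rw [hl]
    cases s with
    | start i =>
      rw [← show _ = g (.start i) from hq x i a,
        ← lintegral_indicator_one (MeasurableSet.singleton _)]
      refine lintegral_congr fun b => ?_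
      cases i <;> cases b <;> simp [xorPairReward, XorState.next]
    | mid => simp [xorPairReward_eq_zero _ _ _ _, g]
    | terminal => simp [xorPairReward_eq_zero _ _ _ _, g]
  -- No transition leads to a start state, so only the initial law contributes to the flow equation
  -- at offset 0.
  have hnext : ∀ (k : ℕ) (y : ((Fin (c + k) → Token XorState Bool) × XorState) × Bool),
      M.stepForward (fun x => g x.2) y = 0 := by
    rintro k ⟨⟨x, s⟩, a⟩
    refine (Kernel.lintegral_deterministic'
      (Measurable.of_discrete : Measurable fun x : XorState × Bool => x.1.next) .of_discrete).trans ?_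
    cases s <;> rfl
  have hinit : ∫⁻ s, g s ∂M.init = 2⁻¹ * (q false + q true) := by
    change ∫⁻ s, g s ∂((PMF.uniformOfFintype Bool).map XorState.start).toMeasure = _
    rw [← PMF.toMeasure_map _ _ (Measurable.of_discrete), lintegral_map hg Measurable.of_discrete,
      lintegral_fintype]
    simp only [PMF.toMeasure_apply_singleton _ _ (MeasurableSet.of_discrete),
      PMF.uniformOfFintype_apply, Fintype.univ_bool, Fintype.card_bool]
    simp [g]
    ring
  have hmain : ∫⁻ y, ENNReal.ofReal (M.lastReward 1 y) ∂M.occupation π 1 =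
      2⁻¹ * (q false + q true) := by
    rw [hd 1 _ hR, hfl.lintegral_succ 0 _ (Measurable.lintegral_kernel_prod_right' hR)]
    simp only [hstep]
    rw [hfl.lintegral_zero (fun x => g x.2) (by fun_prop)]
    simp [hnext, hinit]
  rw [M.value_eq_tsum_occupation, tsum_eq_single 1 hk]
  simp only [hw]
  rw [integral_const_mul, integral_eq_lintegral_of_nonneg_ae (ae_of_all _ hnn)
    (M.measurable_lastReward 1).aestronglyMeasurable, hmain]

/-- The action `!i` after the state `A_i`. -/
def xorAnswer : Token XorState Bool → Bool
  | .inr (.start i, _) => !i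
  | _ => false

/-- The policy that chooses `!i` at `B` after `A_i`. -/
noncomputable def xorActionLaw (c k : ℕ) :
    Kernel ((Fin (c + k) → Token XorState Bool) × XorState) Bool :=
  Kernel.deterministic (fun x => if h : 0 < k then xorAnswer (x.1 ⟨c, by omega⟩) else false) (by
    split
    · exact (Measurable.of_discrete (f := xorAnswer)).comp (by fun_prop)
    · exact measurable_const)

instance (c k : ℕ) : IsMarkovKernel (xorActionLaw c k) := by
  unfold xorActionLaw; infer_instance

theorem value_xorDRMDP_tauPolicy :
    (xorDRMDP c γ h0 h1).value (tauPolicy (xorActionLaw c) inferInstance) = γ := by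
  rw [value_xorDRMDP h0 h1 _ (xorActionLaw c) inferInstance
    ((xorDRMDP c γ h0 h1).disintegrates_occupation_tauPolicy _ _) (fun _ => 1)]
  · rw [one_add_one_eq_two, ENNReal.inv_mul_cancel two_ne_zero ENNReal.ofNat_ne_top]
    simp
  · intro x i a
    have hl : (appendStep x (.start i) a : Fin (c + 0 + 1) → Token XorState Bool) (Fin.last c) =
        Sum.inr (.start i, a) := Fin.snoc_last (α := fun _ => Token XorState Bool) ..
    rw [xorActionLaw, Kernel.deterministic_apply' _ _ (MeasurableSet.singleton _)]
    refine Set.indicator_of_mem ?_ _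
    rw [dif_pos one_pos]
    exact congrArg xorAnswer hl

theorem value_xorDRMDP_of_isState {π : Policy XorState Bool} (hπ : π.IsState) :
    (xorDRMDP c γ h0 h1).value π = γ * 2⁻¹ := by
  obtain ⟨σ, hσ⟩ := hπ
  -- With no completed interval the offset `k` is the time itself, and any history of that length
  -- shows that `σ k s` is an action law of `π`.
  have hm : ∀ k, IsMarkovKernel (σ k) := fun k => ⟨fun s => by
    have h := hσ k [] (Nat.zero_le k) (fun _ => (.mid, false)) s
    rw [duration_nil, Nat.sub_zero] at h
    rw [← h]
    infer_instance⟩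
  let σ' : (k : ℕ) → Kernel ((Fin (c + k) → Token XorState Bool) × XorState) Bool := fun k =>
    (σ k).comap Prod.snd measurable_snd
  have hσ' : ∀ k, IsMarkovKernel (σ' k) := fun k => inferInstance
  have hd : DRMDP.Disintegrates ((xorDRMDP c γ h0 h1).occupation π) σ' := fun k _ hf =>
    (xorDRMDP c γ h0 h1).lintegral_occupation_of_isTau π (fun t L hL τ s => hσ t L hL τ s) hσ' k hf
  rw [value_xorDRMDP h0 h1 π σ' hσ' hd (fun i => σ 1 .mid {!i}) fun x i a => rfl]
  -- The same law at `B` serves both values of `i`, and the two correct answers are complementary.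
  have hsum : σ 1 .mid {!false} + σ 1 .mid {!true} = 1 := by
    have h : ({!true} : Set Bool) = {!false}ᶜ := by ext b; cases b <;> simp
    rw [h, prob_add_prob_compl (MeasurableSet.singleton _)]
  rw [hsum]
  simp

end Xor

end DelayedReward

theorem mainTheorem4 :
    -- finitely many actions: some policy in `Π_{τ,c}` is optimal among all policies
    (∀ (c : ℕ) (S : Type u) (A : Type v) [MeasurableSpace S] [MeasurableSpace A]
        [MeasurableSingletonClass A] [Finite A] [Nonempty A] (M : DRMDP c S A),
        ∃ π : Policy S A, M.IsOptimal π ∧ π.IsTau c) ∧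
    -- arbitrary actions: if there is an optimal policy at all, then there is one in `Π_{τ,c}`
    (∀ (c : ℕ) (S : Type u) (A : Type v) [MeasurableSpace S] [MeasurableSpace A]
        [StandardBorelSpace A] (M : DRMDP c S A),
        (∃ π : Policy S A, M.IsOptimal π) → ∃ π : Policy S A, M.IsOptimal π ∧ π.IsTau c) ∧
    -- the exclusive-or example has optimal policies, but none of them lies in `Π_s`
    (∀ (c : ℕ) (γ : ℝ) (h0 : 0 < γ) (h1 : γ < 1),
        (∃ π : Policy XorState Bool, (xorDRMDP c γ h0.le h1).IsOptimal π) ∧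
        ∀ π : Policy XorState Bool, (xorDRMDP c γ h0.le h1).IsOptimal π → ¬ π.IsState) := by
  refine ⟨fun c S A _ _ _ _ _ M => M.exists_isOptimal_isTau, ?_, ?_⟩
  · rintro c S A _ _ _ M ⟨π, hπ⟩
    obtain ⟨π', hτ, hv⟩ := M.exists_isTau_value_eq π
    exact ⟨π', fun π'' => (hπ π'').trans hv.ge, hτ⟩
  · intro c γ h0 h1
    obtain ⟨π, hπ, -⟩ := (xorDRMDP c γ h0.le h1).exists_isOptimal_isTau
    refine ⟨⟨π, hπ⟩, fun π hπ hs => ?_⟩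
    -- Optimality would force `γ ≤ γ / 2`, which is impossible for positive `γ`.
    have h := hπ (tauPolicy (xorActionLaw c) inferInstance)
    rw [value_xorDRMDP_tauPolicy, value_xorDRMDP_of_isState h0.le h1 hs] at h
    linarith
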